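/- Let $K\subset\mathbb{R}^n$ be an open symmetric convex cone with $\{\kappa:\kappa_i\ge 0 \text{ for all } i\}\subsetneq \overline K$, and let $f:\overline K\to\mathbb{R}$ be a continuous symmetric function, differentiable in $K$, such that $\partial f/\partial\kappa_i>0$ in $K$ for $1\le i\le n$, $f$ is concave in $K$, $f>0$ in $K$, $f=0$ on $\partial K$, $f(1,\dots,1)=1$, and $f$ is homogeneous of degree one. For a real symmetric $n\times n$ matrix $A$ with vector of eigenvalues $\kappa[A]\in\overline K$ put $F(A)=f(\kappa[A])$; $F(A)$ is defined only for such $A$. For $\eta\in\mathbb{R}^n$ let $\gamma_\eta=I-\eta\otimes\eta$. Let $D\subset\mathbb{R}^n$ be open. A function $\phi\in C^\infty(\mathbb{R}^n)$ is *admissible* on $D$ if, at each $x\in D$: if $D\phi(x)\ne0$, then $F(\gamma_\eta D^2\phi(x)\gamma_\eta)$ is defined and positive for $\eta=D\phi(x)/|D\phi(x)|$; if $D\phi(x)=0$, then $F(\gamma_\eta D^2\phi(x)\gamma_\eta)$ is defined and positive for some $\eta\in\mathbb{R}^n$ with $|\eta|\le1$. Let $U\subset\mathbb{R}^n$ be a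 bounded open set. A function $u\in C(\overline U)$ is a *weak subsolution* of $$F(\gamma^{ik}u_{kl}\gamma^{lj})=1\quad\text{in }U,\qquad \gamma^{ij}=\delta_{ij}-\frac{u_iu_j}{|Du|^2},\tag{1}$$ if for every open $D\subset U$, every $\phi\in C^\infty(\mathbb{R}^n)$ admissible on $D$, and every $x_0\in D$ at which $u-\phi$ has a local maximum: if $D\phi(x_0)\ne0$, then $F(\gamma_\eta D^2\phi(x_0)\gamma_\eta)\ge1$ for $\eta=D\phi(x_0)/|D\phi(x_0)|$; if $D\phi(x_0)=0$, then $F(\gamma_\eta D^2\phi(x_0)\gamma_\eta)$ is defined and $\ge1$ for some $\eta\in\mathbb{R}^n$ with $|\eta|\le1$. A *weak supersolution* is defined in the same way, with local minimum in place of local maximum and $\le1$ in place of $\ge1$. **Theorem.** Let $u\in C(\overline U)$ be a weak subsolution of (1) with $u\le0$ on $\partial U$, and let $v\in C(\overline U)$ be a weak supersolution of (1) with $v\ge0$ on $\partial U$ (in particular, $u=v=0$ on $\partial U$ is allowed). Then $u\le v$ in $U$. -/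

import Mathlib

open scoped ContDiff

namespace GeneralCurvature

/-- The structure conditions on a symmetric function `f` of the principal curvatures, which is
defined on the closure of an open symmetric convex cone `K ⊆ ℝⁿ`. Nothing is required of the values
of `f` outside `closure K`. -/
structure IsCurvatureFunction {n : ℕ} (K : Set (Fin n → ℝ)) (f : (Fin n → ℝ) → ℝ) : Prop where
  isOpen : IsOpen K
  convex : Convex ℝ K
  cone : ∀ κ ∈ K, ∀ t : ℝ, 0 < t → t • κ ∈ K
  symm_cone : ∀ κ ∈ K, ∀ σ : Equiv.Perm (Fin n), κ ∘ σ ∈ K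
  orthant_ssubset : {κ : Fin n → ℝ | ∀ i, 0 ≤ κ i} ⊂ closure K
  symm : ∀ κ ∈ K, ∀ σ : Equiv.Perm (Fin n), f (κ ∘ σ) = f κ
  continuousOn : ContinuousOn f (closure K)
  differentiableAt : ∀ κ ∈ K, DifferentiableAt ℝ f κ
  partial_pos : ∀ κ ∈ K, ∀ i, 0 < fderiv ℝ f κ (Pi.single i 1)
  concave : ConcaveOn ℝ K f
  pos : ∀ κ ∈ K, 0 < f κ
  eq_zero : ∀ κ ∈ frontier K, f κ = 0
  normalized : f (fun _ => 1) = 1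
  homogeneous : ∀ κ ∈ K, ∀ t : ℝ, 0 < t → f (t • κ) = t * f κ

open Classical in
/-- The vector `κ[A]` of the eigenvalues, with multiplicity, of a real symmetric matrix `A`
(only applied to symmetric matrices, see `isHermitian_projHessian`). -/
noncomputable def eigenvalueVec {n : ℕ} (A : Matrix (Fin n) (Fin n) ℝ) : Fin n → ℝ :=
  if h : A.IsHermitian then h.eigenvalues else 0

/-- `F(A) = f(κ[A])`; it is meaningful when `κ[A] ∈ closure K`. -/
noncomputable def curvF {n : ℕ} (f : (Fin n → ℝ) → ℝ) (A : Matrix (Fin n) (Fin n) ℝ) : ℝ :=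
  f (eigenvalueVec A)

/-- `A` is in the domain of `F`. -/
def InDomain {n : ℕ} (K : Set (Fin n → ℝ)) (A : Matrix (Fin n) (Fin n) ℝ) : Prop :=
  eigenvalueVec A ∈ closure K

/-- The Hessian matrix `D²φ(x)`. -/
noncomputable def hessian {n : ℕ} (φ : EuclideanSpace ℝ (Fin n) → ℝ)
    (x : EuclideanSpace ℝ (Fin n)) : Matrix (Fin n) (Fin n) ℝ :=
  Matrix.of fun i j =>
    iteratedFDeriv ℝ 2 φ x ![EuclideanSpace.single i 1, EuclideanSpace.single j 1]

/-- `γ_η = I - η ⊗ η`. -/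
def gammaMat {n : ℕ} (η : EuclideanSpace ℝ (Fin n)) : Matrix (Fin n) (Fin n) ℝ :=
  Matrix.of fun i j => (if i = j then 1 else 0) - η i * η j

/-- The matrix `γ_η D²φ(x) γ_η`, with entries `γ_η^{ik} φ_{kl}(x) γ_η^{lj}`. -/
noncomputable def projHessian {n : ℕ} (φ : EuclideanSpace ℝ (Fin n) → ℝ)
    (η x : EuclideanSpace ℝ (Fin n)) : Matrix (Fin n) (Fin n) ℝ :=
  gammaMat η * hessian φ x * gammaMat η

/-- The direction `Dφ(x) / |Dφ(x)|`, used only where `Dφ(x) ≠ 0`. -/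
noncomputable def unitGrad {n : ℕ} (φ : EuclideanSpace ℝ (Fin n) → ℝ)
    (x : EuclideanSpace ℝ (Fin n)) : EuclideanSpace ℝ (Fin n) :=
  ‖gradient φ x‖⁻¹ • gradient φ x

theorem isHermitian_projHessian {n : ℕ} {φ : EuclideanSpace ℝ (Fin n) → ℝ} (hφ : ContDiff ℝ ∞ φ)
    (η x : EuclideanSpace ℝ (Fin n)) : (projHessian φ η x).IsHermitian := by
  have hH : (hessian φ x).transpose = hessian φ x := by
    ext i j
    have hs : IsSymmSndFDerivAt ℝ φ x := by
      apply hφ.contDiffAt.isSymmSndFDerivAt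
      rw [minSmoothness_of_isRCLikeNormedField]
      exact WithTop.coe_le_coe.2 (le_top : (2 : ℕ∞) ≤ ⊤)
    simp only [hessian, Matrix.transpose_apply, Matrix.of_apply, iteratedFDeriv_two_apply]
    exact hs _ _
  have hg : (gammaMat η).transpose = gammaMat η := by
    ext i j
    simp [gammaMat, eq_comm, mul_comm]
  rw [Matrix.IsHermitian, Matrix.conjTranspose_eq_transpose_of_trivial, projHessian,
    Matrix.transpose_mul, Matrix.transpose_mul, hH, hg, Matrix.mul_assoc]

/-- `φ ∈ Λ(D)`: at each point of `D`, `F(γ D²φ γ)` is defined and positive if `Dφ ≠ 0`, and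
`F(γ_η D²φ γ_η)` is defined and positive for some `|η| ≤ 1` if `Dφ = 0`. -/
def Admissible {n : ℕ} (K : Set (Fin n → ℝ)) (f : (Fin n → ℝ) → ℝ)
    (D : Set (EuclideanSpace ℝ (Fin n))) (φ : EuclideanSpace ℝ (Fin n) → ℝ) : Prop :=
  ∀ x ∈ D,
    (gradient φ x ≠ 0 →
      InDomain K (projHessian φ (unitGrad φ x) x) ∧
        0 < curvF f (projHessian φ (unitGrad φ x) x)) ∧
    (gradient φ x = 0 →
      ∃ η : EuclideanSpace ℝ (Fin n), ‖η‖ ≤ 1 ∧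
        InDomain K (projHessian φ η x) ∧ 0 < curvF f (projHessian φ η x))

/-- `u ∈ C(closure U)` is a weak subsolution of `F(γ^{ik} u_{kl} γ^{lj}) = 1` in `U`. -/
def IsWeakSubsolution {n : ℕ} (K : Set (Fin n → ℝ)) (f : (Fin n → ℝ) → ℝ)
    (U : Set (EuclideanSpace ℝ (Fin n))) (u : EuclideanSpace ℝ (Fin n) → ℝ) : Prop :=
  ContinuousOn u (closure U) ∧
  ∀ (D : Set (EuclideanSpace ℝ (Fin n))) (φ : EuclideanSpace ℝ (Fin n) → ℝ),
    IsOpen D → D ⊆ U → ContDiff ℝ ∞ φ → Admissible K f D φ →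
    ∀ x₀ ∈ D, IsLocalMax (fun x => u x - φ x) x₀ →
      (gradient φ x₀ ≠ 0 → 1 ≤ curvF f (projHessian φ (unitGrad φ x₀) x₀)) ∧
      (gradient φ x₀ = 0 → ∃ η : EuclideanSpace ℝ (Fin n), ‖η‖ ≤ 1 ∧
        InDomain K (projHessian φ η x₀) ∧ 1 ≤ curvF f (projHessian φ η x₀))

/-- `v ∈ C(closure U)` is a weak supersolution of `F(γ^{ik} v_{kl} γ^{lj}) = 1` in `U`. -/
def IsWeakSupersolution {n : ℕ} (K : Set (Fin n → ℝ)) (f : (Fin n → ℝ) → ℝ)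
    (U : Set (EuclideanSpace ℝ (Fin n))) (v : EuclideanSpace ℝ (Fin n) → ℝ) : Prop :=
  ContinuousOn v (closure U) ∧
  ∀ (D : Set (EuclideanSpace ℝ (Fin n))) (φ : EuclideanSpace ℝ (Fin n) → ℝ),
    IsOpen D → D ⊆ U → ContDiff ℝ ∞ φ → Admissible K f D φ →
    ∀ x₀ ∈ D, IsLocalMin (fun x => v x - φ x) x₀ →
      (gradient φ x₀ ≠ 0 → curvF f (projHessian φ (unitGrad φ x₀) x₀) ≤ 1) ∧
      (gradient φ x₀ = 0 → ∃ η : EuclideanSpace ℝ (Fin n), ‖η‖ ≤ 1 ∧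
        InDomain K (projHessian φ η x₀) ∧ curvF f (projHessian φ η x₀) ≤ 1)

end GeneralCurvature

/-! Multiplying `u` by `lam > 1` leaves the projection onto level sets unchanged and, by
homogeneity, turns `F ≥ 1` into `F ≥ lam`. It therefore suffices to show `lam * u ≤ v` for each such
`lam` (`comparison_of_strict`) and let `lam → 1`.

If `lam * u - v` is positive somewhere, replace `lam * u` and `-v` by their sup-convolutions `P` and
`Q`, which are semiconvex, and maximize `P x + Q y - N ‖x - y‖ ^ 4`. For large `N` the points of `U`
where the sup-convolutions are attained stay away from the boundary
(`exists_penalty_forces_interior`). If the maximum lies on the diagonal, the quartic penalty makes a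
flat paraboloid touch `u` from above, which `not_flat_touch` forbids.

Otherwise, let `k₀ ≠ 0` be the difference of the two maximizing variables. Along `x - y = k₀` the
penalty is constant, so `x ↦ P (x + k₀) + Q x` has a maximum. A Jensen-type lemma
(`exists_max_hasFDerivAt_selection`) gives nearby maxima of small linear perturbations, at which
both summands have second order expansions whose Hessians have nonpositive sum. The expansions
transfer to `u` and `v` as touching paraboloids. The limiting gradient is nonzero
(`ne_zero_of_inner_le_quartic`), so in the limit ordered Hessians are projected along the same
direction. Monotonicity of `F` then gives `lam ≤ F ≤ 1` (`false_of_tendsto_hessians`), a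
contradiction.

The Jensen-type lemma works with a selection of subgradients: it is Lipschitz on the set of maximum
points, its image covers a ball, so that set has positive measure and contains a density point of
differentiability. -/

open Filter Topology MeasureTheory Metric Set

namespace GeneralCurvature

/-! ### Semiconvex functions: second order expansions at maximum points. -/

section Semiconvex

variable {E : Type*} [NormedAddCommGroup E] [InnerProductSpace ℝ E]

/-- `g` is semiconvex, and `s` selects at each point the gradient of a paraboloid of opening `-2K`
that supports the graph of `g` from below. -/
def SemiconvexSelection (K : ℝ) (g : E → ℝ) (s : E → E) : Prop :=
  ∀ x y, g x + inner ℝ (s x) (y - x) - K * ‖y - x‖ ^ 2 ≤ g y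

theorem eq_zero_of_inner_le_mul_norm_sq {q : E} {M : ℝ} (h : ∀ x, inner ℝ q x ≤ M * ‖x‖ ^ 2) :
    q = 0 := by
  have h1 := h ((1 / (2 * (|M| + 1))) • q)
  have hM : 0 < |M| + 1 := by positivity
  rw [inner_smul_right, real_inner_self_eq_norm_sq, norm_smul, mul_pow, Real.norm_eq_abs,
    sq_abs] at h1
  have h2 : M * ((1 / (2 * (|M| + 1))) ^ 2 * ‖q‖ ^ 2)
      ≤ (|M| + 1) * ((1 / (2 * (|M| + 1))) ^ 2 * ‖q‖ ^ 2) := by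
    gcongr
    linarith [le_abs_self M]
  have h3 : (|M| + 1) * ((1 / (2 * (|M| + 1))) ^ 2 * ‖q‖ ^ 2)
      = (1 / 2) * (1 / (2 * (|M| + 1)) * ‖q‖ ^ 2) := by
    field_simp
  have h4 : 1 / (2 * (|M| + 1)) * ‖q‖ ^ 2 ≤ 0 := by linarith
  have h5 : ‖q‖ ^ 2 ≤ 0 := by
    by_contra hc
    push Not at hc
    have : 0 < 1 / (2 * (|M| + 1)) * ‖q‖ ^ 2 := by positivity
    linarith
  have : ‖q‖ = 0 := by nlinarith [norm_nonneg q]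
  simpa using this

/-- Only `z` needs a paraboloid from above; `x` is arbitrary. This asymmetry is what later extends
differentiability from a subset to a full neighbourhood. -/
theorem SemiconvexSelection.norm_sub_le {K : ℝ} (hK : 0 ≤ K) {g : E → ℝ} {s : E → E}
    (hs : SemiconvexSelection K g s) {z : E}
    (hz : ∀ y, g y ≤ g z + inner ℝ (s z) (y - z) + K * ‖y - z‖ ^ 2) (x : E) :
    ‖s x - s z‖ ≤ 6 * K * ‖x - z‖ := by
  rcases eq_or_ne (s x) (s z) with h | h
  · rw [h, sub_self, norm_zero]; positivity
  rcases eq_or_ne x z with h' | h'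
  · exact absurd (by rw [h']) h
  have hd : 0 < ‖s x - s z‖ := norm_pos_iff.2 (sub_ne_zero.2 h)
  have hr : 0 < ‖x - z‖ := norm_pos_iff.2 (sub_ne_zero.2 h')
  set d := s x - s z with hdd
  set r := ‖x - z‖ with hrr
  -- The inequalities are compared at `x + e`, a step of length `r` along the difference of the
  -- slopes. The quadratic errors are `K r²`, `K (2r)²` and `K r²`, whence the factor 6.
  set e : E := (r / ‖d‖) • d with he
  have hne : ‖e‖ = r := by
    rw [he, norm_smul, Real.norm_eq_abs, abs_of_pos (by positivity)]
    field_simp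
  have hde : inner ℝ d e = r * ‖d‖ := by
    rw [he, inner_smul_right, real_inner_self_eq_norm_sq]
    field_simp
  have h1 := hs x (x + e)
  have h2 := hz (x + e)
  have h3 := hs z x
  have h4 : ‖x + e - z‖ ≤ 2 * r := by
    calc ‖x + e - z‖ = ‖(x - z) + e‖ := by congr 1; abel
      _ ≤ ‖x - z‖ + ‖e‖ := norm_add_le _ _
      _ = 2 * r := by rw [hne]; ring
  have h5 : ‖x + e - z‖ ^ 2 ≤ 4 * r ^ 2 := by
    nlinarith [norm_nonneg (x + e - z)]
  rw [add_sub_cancel_left, hne] at h1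
  have h6 : inner ℝ (s z) (x + e - z) = inner ℝ (s z) (x - z) + inner ℝ (s z) e := by
    rw [← inner_add_right]; congr 1; abel
  have h7 : inner ℝ d e = inner ℝ (s x) e - inner ℝ (s z) e := by
    rw [hdd, inner_sub_left]
  have h8 : K * ‖x + e - z‖ ^ 2 ≤ K * (4 * r ^ 2) := by gcongr
  have h9 : r * ‖d‖ ≤ r * (6 * K * r) := by nlinarith
  exact le_of_mul_le_mul_left h9 hr

/-- Over a partition into `m` equal steps the quadratic errors add up to only `B / m`, which
vanishes in the limit. -/
theorem abs_sub_le_of_abs_sub_le_add_sq {χ : ℝ → ℝ} {ε B : ℝ}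
    (h : ∀ t ∈ Icc (0 : ℝ) 1, ∀ t' ∈ Icc (0 : ℝ) 1,
      |χ t' - χ t| ≤ ε * |t' - t| + B * (t' - t) ^ 2) :
    |χ 1 - χ 0| ≤ ε := by
  have key : ∀ m : ℕ, 0 < m → |χ 1 - χ 0| ≤ ε + B / m := by
    intro m hm
    have hm' : (0 : ℝ) < m := by exact_mod_cast hm
    have ind : ∀ k : ℕ, k ≤ m → |χ ((k : ℝ) / m) - χ 0| ≤ k * (ε / m + B / m ^ 2) := by
      intro k
      induction k with
      | zero => intro _; simp
      | succ k ih =>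
        intro hk
        have hk' : (k : ℝ) + 1 ≤ m := by exact_mod_cast hk
        have h1 := ih (by omega)
        have h2 := h ((k : ℝ) / m) ⟨by positivity, by rw [div_le_one hm']; linarith⟩
          (((k + 1 : ℕ) : ℝ) / m)
          ⟨by positivity, by rw [div_le_one hm']; push_cast; linarith⟩
        have h3 : ((k + 1 : ℕ) : ℝ) / m - (k : ℝ) / m = 1 / m := by
          push_cast; field_simp; ring
        rw [h3, abs_of_pos (by positivity : (0 : ℝ) < 1 / m)] at h2
        have h4 : |χ (((k + 1 : ℕ) : ℝ) / m) - χ 0|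
            ≤ |χ (((k + 1 : ℕ) : ℝ) / m) - χ ((k : ℝ) / m)| + |χ ((k : ℝ) / m) - χ 0| :=
          abs_sub_le _ _ _
        have h5 : ε * (1 / m) + B * (1 / (m : ℝ)) ^ 2 = ε / m + B / m ^ 2 := by
          field_simp
        push_cast at *
        linarith
    have h1 := ind m le_rfl
    rw [div_self hm'.ne'] at h1
    have h2 : (m : ℝ) * (ε / m + B / m ^ 2) = ε + B / m := by field_simp
    linarith
  have hlim : Tendsto (fun m : ℕ => ε + B / (m : ℝ)) atTop (𝓝 (ε + 0)) :=
    tendsto_const_nhds.add (tendsto_const_div_atTop_nhds_zero_nat B)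
  rw [add_zero] at hlim
  exact ge_of_tendsto hlim (eventually_atTop.2 ⟨1, fun m hm => key m hm⟩)

/-- A semiconvex function has a second order Taylor expansion wherever its gradient selection is
differentiable. -/
theorem SemiconvexSelection.taylor {K : ℝ} {g : E → ℝ} {s : E → E}
    (hs : SemiconvexSelection K g s) {z : E} {A : E →L[ℝ] E} (hA : HasFDerivAt s A z)
    {ε : ℝ} (hε : 0 < ε) :
    ∀ᶠ h in 𝓝 (0 : E),
      |g (z + h) - g z - inner ℝ (s z) h - 1 / 2 * inner ℝ (A h) h| ≤ ε * ‖h‖ ^ 2 := by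
  have h0 := (hasFDerivAt_iff_isLittleO_nhds_zero.1 hA)
  have h1 := (Asymptotics.isLittleO_iff.1 h0) hε
  obtain ⟨r, hr, hball⟩ := Metric.eventually_nhds_iff_ball.1 h1
  refine Metric.eventually_nhds_iff_ball.2 ⟨r, hr, fun h hh => ?_⟩
  set χ : ℝ → ℝ := fun t => g (z + t • h) - t * inner ℝ (s z) h - t ^ 2 / 2 * inner ℝ (A h) h
    with hχ
  -- Support from below at `z + t • h` gives a one-sided bound. Exchanging `t` and `t'` gives the
  -- other side. The coefficient of `(t' - t) ^ 2` need not be small.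
  have low : ∀ t ∈ Icc (0 : ℝ) 1, ∀ t' : ℝ,
      -(ε * ‖h‖ ^ 2 * |t' - t|) - |K * ‖h‖ ^ 2 + 1 / 2 * inner ℝ (A h) h| * (t' - t) ^ 2
        ≤ χ t' - χ t := by
    intro t ht t'
    have hth : t • h ∈ ball (0 : E) r := by
      rw [mem_ball_zero_iff, norm_smul, Real.norm_eq_abs, abs_of_nonneg ht.1]
      rw [mem_ball_zero_iff] at hh
      nlinarith [norm_nonneg h, ht.2]
    have e1 := hball _ hth
    rw [norm_smul, Real.norm_eq_abs, abs_of_nonneg ht.1] at e1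
    have e2 := hs (z + t • h) (z + t' • h)
    have e3 : z + t' • h - (z + t • h) = (t' - t) • h := by rw [sub_smul]; abel
    rw [e3, inner_smul_right, norm_smul, Real.norm_eq_abs, mul_pow, sq_abs] at e2
    set D := s (z + t • h) - s z - A (t • h) with hD
    have e4 : inner ℝ (s (z + t • h)) h
        = inner ℝ D h + inner ℝ (s z) h + t * inner ℝ (A h) h := by
      rw [hD, inner_sub_left, inner_sub_left, map_smul, real_inner_smul_left]; ring
    have e5 : |inner ℝ D h| ≤ ε * ‖h‖ ^ 2 := by
      refine (abs_real_inner_le_norm _ _).trans ?_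
      have : ‖D‖ ≤ ε * ‖h‖ := e1.trans (by
        have := mul_le_mul_of_nonneg_right ht.2 (norm_nonneg h)
        rw [one_mul] at this
        gcongr)
      nlinarith [norm_nonneg h]
    have e6 : -(ε * ‖h‖ ^ 2 * |t' - t|) ≤ (t' - t) * inner ℝ D h := by
      have h7 : |(t' - t) * inner ℝ D h| ≤ |t' - t| * (ε * ‖h‖ ^ 2) := by
        rw [abs_mul]; gcongr
      have := neg_abs_le ((t' - t) * inner ℝ D h)
      linarith
    have e7 := mul_le_mul_of_nonneg_right (le_abs_self (K * ‖h‖ ^ 2 + 1 / 2 * inner ℝ (A h) h))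
      (sq_nonneg (t' - t))
    rw [e4] at e2
    simp only [hχ]
    nlinarith
  have main := abs_sub_le_of_abs_sub_le_add_sq (χ := χ) (ε := ε * ‖h‖ ^ 2)
    (B := |K * ‖h‖ ^ 2 + 1 / 2 * inner ℝ (A h) h|) (by
      intro t ht t' ht'
      have l1 := low t ht t'
      have l2 := low t' ht' t
      rw [abs_sub_comm t t'] at l2
      rw [abs_le]
      constructor <;> nlinarith)
  have e : χ 1 - χ 0 = g (z + h) - g z - inner ℝ (s z) h - 1 / 2 * inner ℝ (A h) h := by
    simp only [hχ, one_smul, zero_smul, add_zero]; ring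
  rwa [e] at main

/-- Each `y` near `z` has a point of `C` at distance `o(‖y - z‖)`, and moving from it to `y` changes
`s` by a comparable amount. -/
theorem hasFDerivAt_of_hasFDerivWithinAt_of_density {F : Type*} [NormedAddCommGroup F]
    [NormedSpace ℝ F] {s : E → F} {A : E →L[ℝ] F} {C : Set E} {z : E} {L : ℝ}
    (hA : HasFDerivWithinAt s A C z)
    (hC : ∀ η > 0, ∀ᶠ y in 𝓝 z, ∃ z' ∈ C, ‖y - z'‖ ≤ η * ‖y - z‖)
    (hL : ∀ z' ∈ C, ∀ x, ‖s x - s z'‖ ≤ L * ‖x - z'‖) : HasFDerivAt s A z := by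
  rw [hasFDerivAt_iff_isLittleO, Asymptotics.isLittleO_iff]
  intro c hc
  rw [hasFDerivWithinAt_iff_isLittleO, Asymptotics.isLittleO_iff] at hA
  have h1 := hA (show 0 < c / 4 by positivity)
  rw [eventually_nhdsWithin_iff, Metric.eventually_nhds_iff_ball] at h1
  obtain ⟨r, hr, h1⟩ := h1
  set M := |L| + ‖A‖ + 1 with hM
  have hMpos : 0 < M := by positivity
  set η := min 1 (c / (2 * M)) with hη
  have hηpos : 0 < η := lt_min one_pos (by positivity)
  have hη1 : η ≤ 1 := min_le_left _ _
  have hη2 : M * η ≤ c / 2 := by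
    calc M * η ≤ M * (c / (2 * M)) := by gcongr; exact min_le_right _ _
      _ = c / 2 := by field_simp
  filter_upwards [hC η hηpos, ball_mem_nhds z (half_pos hr)] with y ⟨z', hz', hyz'⟩ hy
  rw [mem_ball, dist_eq_norm] at hy
  have hz'z : ‖z' - z‖ ≤ 2 * ‖y - z‖ := by
    calc ‖z' - z‖ = ‖(y - z) - (y - z')‖ := by congr 1; abel
      _ ≤ ‖y - z‖ + ‖y - z'‖ := norm_sub_le _ _
      _ ≤ 2 * ‖y - z‖ := by nlinarith [norm_nonneg (y - z)]
  have h2 := h1 z' (by rw [mem_ball, dist_eq_norm]; linarith) hz'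
  have e : s y - s z - A (y - z) = (s y - s z') + (s z' - s z - A (z' - z)) - A (y - z') := by
    have : A (y - z) = A (y - z') + A (z' - z) := by rw [← map_add]; congr 1; abel
    rw [this]; abel
  have h3 := hL z' hz' y
  have h4 := A.le_opNorm (y - z')
  calc ‖s y - s z - A (y - z)‖ ≤ ‖s y - s z'‖ + ‖s z' - s z - A (z' - z)‖ + ‖A (y - z')‖ := by
        rw [e]; exact (norm_sub_le _ _).trans (by gcongr; exact norm_add_le _ _)
    _ ≤ |L| * ‖y - z'‖ + c / 4 * ‖z' - z‖ + ‖A‖ * ‖y - z'‖ := by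
        have : L * ‖y - z'‖ ≤ |L| * ‖y - z'‖ := by gcongr; exact le_abs_self L
        linarith
    _ ≤ M * ‖y - z'‖ + c / 4 * (2 * ‖y - z‖) := by
        have : c / 4 * ‖z' - z‖ ≤ c / 4 * (2 * ‖y - z‖) := by gcongr
        rw [hM]; nlinarith [norm_nonneg (y - z')]
    _ ≤ M * (η * ‖y - z‖) + c / 4 * (2 * ‖y - z‖) := by gcongr
    _ ≤ c * ‖y - z‖ := by nlinarith [norm_nonneg (y - z)]

variable [FiniteDimensional ℝ E] [MeasurableSpace E] [BorelSpace E]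

/-- A ball of radius `η * ‖y - z‖` about `y` that missed `C` would take the fixed proportion `(η /
2) ^ d` from the ball of radius `2 * ‖y - z‖` about `z`, contradicting density one. -/
theorem eventually_exists_mem_norm_sub_le_of_density (μ : Measure E) [μ.IsAddHaarMeasure]
    {C : Set E} {z : E} (hz : z ∈ C)
    (h : Tendsto (fun r => μ (C ∩ closedBall z r) / μ (closedBall z r)) (𝓝[>] 0) (𝓝 1))
    {η : ℝ} (hη : 0 < η) :
    ∀ᶠ y in 𝓝 z, ∃ z' ∈ C, ‖y - z'‖ ≤ η * ‖y - z‖ := by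
  wlog hη1 : η ≤ 1 generalizing η
  · filter_upwards [this one_pos le_rfl] with y ⟨z', hz', hy⟩
    exact ⟨z', hz', hy.trans (by push Not at hη1; gcongr)⟩
  set d := Module.finrank ℝ E
  set c : ENNReal := ENNReal.ofReal ((η / 2) ^ d) with hc
  have hcpos : 0 < c := by rw [hc, ENNReal.ofReal_pos]; positivity
  have h1 : ∀ᶠ r in 𝓝[>] (0 : ℝ), 1 - c < μ (C ∩ closedBall z r) / μ (closedBall z r) :=
    h.eventually (lt_mem_nhds (ENNReal.sub_lt_self ENNReal.one_ne_top one_ne_zero hcpos.ne'))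
  rw [eventually_nhdsWithin_iff, Metric.eventually_nhds_iff_ball] at h1
  obtain ⟨ε, hε, h1⟩ := h1
  filter_upwards [ball_mem_nhds z (half_pos hε)] with y hy
  rcases eq_or_ne y z with rfl | hyz
  · exact ⟨y, hz, by simp⟩
  by_contra hcon
  push Not at hcon
  rw [mem_ball, dist_eq_norm] at hy
  have hpos : 0 < ‖y - z‖ := norm_pos_iff.2 (sub_ne_zero.2 hyz)
  set r := 2 * ‖y - z‖ with hr
  have h2 := h1 r (by rw [mem_ball, Real.dist_eq, sub_zero, abs_of_pos (by positivity)]; linarith)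
    (show (0 : ℝ) < r by positivity)
  set M := μ (closedBall z r)
  have hM0 : M ≠ 0 := (measure_closedBall_pos μ z (by positivity)).ne'
  have hMt : M ≠ ⊤ := measure_closedBall_lt_top.ne
  have hB : μ (closedBall y (η * ‖y - z‖)) = c * M := by
    have e : η * ‖y - z‖ = (η / 2) * r := by rw [hr]; ring
    rw [e, Measure.addHaar_closedBall_mul μ y (by positivity) (by positivity),
      ← Measure.addHaar_closedBall_center μ z, hc]
  have hdisj : Disjoint (C ∩ closedBall z r) (closedBall y (η * ‖y - z‖)) := by
    rw [Set.disjoint_left]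
    rintro x ⟨hxC, -⟩ hxy
    rw [mem_closedBall, dist_comm, dist_eq_norm] at hxy
    exact absurd hxy (not_le.2 (hcon x hxC))
  have hsub : (C ∩ closedBall z r) ∪ closedBall y (η * ‖y - z‖) ⊆ closedBall z r := by
    refine union_subset inter_subset_right (closedBall_subset_closedBall' ?_)
    rw [dist_eq_norm, hr]; nlinarith
  have h3 : μ (C ∩ closedBall z r) + c * M ≤ M := by
    rw [← hB, ← measure_union hdisj measurableSet_closedBall]
    exact measure_mono hsub
  have h4 : μ (C ∩ closedBall z r) / M + c ≤ 1 := by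
    have : (μ (C ∩ closedBall z r) + c * M) / M ≤ 1 := by
      rw [ENNReal.div_le_iff hM0 hMt, one_mul]; exact h3
    rwa [ENNReal.add_div, ENNReal.mul_div_cancel_right hM0 hMt] at this
  have h5 : 1 < μ (C ∩ closedBall z r) / M + c := by
    have hct : c ≠ ⊤ := ENNReal.ofReal_ne_top
    exact (ENNReal.sub_lt_iff_lt_right hct (by
      rw [hc, ENNReal.ofReal_le_one]
      exact pow_le_one₀ (by positivity) (by linarith))).1 h2
  exact absurd h5 (not_lt.2 h4)

/-- A sum of two semiconvex functions whose small linear perturbations all attain a global maximum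
has such a maximum point at which both functions are twice differentiable. -/
theorem exists_max_hasFDerivAt_selection {K : ℝ} (hK : 0 ≤ K) {g₁ g₂ : E → ℝ} {s₁ s₂ : E → E}
    (h₁ : SemiconvexSelection K g₁ s₁) (h₂ : SemiconvexSelection K g₂ s₂)
    (hc : Continuous fun x => g₁ x + g₂ x) {δ : ℝ} (hδ : 0 < δ)
    (hmax : ∀ p : E, ‖p‖ ≤ δ → ∃ z, ∀ y,
      g₁ y + g₂ y ≤ g₁ z + g₂ z + inner ℝ p (y - z)) :
    ∃ (z : E) (A₁ A₂ : E →L[ℝ] E), ‖s₁ z + s₂ z‖ ≤ δ ∧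
      (∀ y, g₁ y + g₂ y ≤ g₁ z + g₂ z + inner ℝ (s₁ z + s₂ z) (y - z)) ∧
      HasFDerivAt s₁ A₁ z ∧ HasFDerivAt s₂ A₂ z ∧ ‖A₁‖ ≤ 6 * K ∧ ‖A₂‖ ≤ 6 * K ∧
      ∀ h, inner ℝ (A₁ h) h + inner ℝ (A₂ h) h ≤ 0 := by
  -- At a maximum point the supporting slope is unique. So limits of slopes are again values of `s₁
  -- + s₂`, and `C` below is closed although the selections need not be continuous.
  have huniq : ∀ z p, (∀ y, g₁ y + g₂ y ≤ g₁ z + g₂ z + inner ℝ p (y - z)) →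
      p = s₁ z + s₂ z := by
    intro z p hp
    have : s₁ z + s₂ z - p = 0 := by
      refine eq_zero_of_inner_le_mul_norm_sq (M := 2 * K) fun x => ?_
      have a1 := h₁ z (z + x)
      have a2 := h₂ z (z + x)
      have a3 := hp (z + x)
      rw [add_sub_cancel_left] at a1 a2 a3
      rw [inner_sub_left, inner_add_left]
      linarith
    exact (sub_eq_zero.1 this).symm
  set C : Set E := {z | ‖s₁ z + s₂ z‖ ≤ δ ∧
    ∀ y, g₁ y + g₂ y ≤ g₁ z + g₂ z + inner ℝ (s₁ z + s₂ z) (y - z)} with hC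
  have hclosed : IsClosed C := by
    refine isClosed_of_closure_subset fun z hz => ?_
    obtain ⟨x, hxC, hxz⟩ := mem_closure_iff_seq_limit.1 hz
    obtain ⟨p, hp, φ, hφ, hlim⟩ := (isCompact_closedBall (0 : E) δ).tendsto_subseq
      (x := fun k => s₁ (x k) + s₂ (x k)) (fun k => by simpa using (hxC k).1)
    have hxz' := hxz.comp hφ.tendsto_atTop
    have hp' : ∀ y, g₁ y + g₂ y ≤ g₁ z + g₂ z + inner ℝ p (y - z) := by
      intro y
      have t1 := ((hc.tendsto z).comp hxz').add (hlim.inner (tendsto_const_nhds (x := y) |>.sub hxz'))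
      exact ge_of_tendsto' t1 fun k => (hxC (φ k)).2 y
    have e := huniq z p hp'
    refine ⟨by rw [← e]; simpa using hp, by rw [← e]; exact hp'⟩
  have hup₁ : ∀ z ∈ C, ∀ y, g₁ y ≤ g₁ z + inner ℝ (s₁ z) (y - z) + K * ‖y - z‖ ^ 2 := by
    intro z hz y
    have a1 := hz.2 y
    have a2 := h₂ z y
    rw [inner_add_left] at a1
    linarith
  have hup₂ : ∀ z ∈ C, ∀ y, g₂ y ≤ g₂ z + inner ℝ (s₂ z) (y - z) + K * ‖y - z‖ ^ 2 := by
    intro z hz y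
    have a1 := hz.2 y
    have a2 := h₁ z y
    rw [inner_add_left] at a1
    linarith
  have hL₁ : ∀ z ∈ C, ∀ x, ‖s₁ x - s₁ z‖ ≤ 6 * K * ‖x - z‖ :=
    fun z hz => h₁.norm_sub_le hK (hup₁ z hz)
  have hL₂ : ∀ z ∈ C, ∀ x, ‖s₂ x - s₂ z‖ ≤ 6 * K * ‖x - z‖ :=
    fun z hz => h₂.norm_sub_le hK (hup₂ z hz)
  have hlip₁ : LipschitzOnWith (Real.toNNReal (6 * K)) s₁ C :=
    LipschitzOnWith.of_dist_le_mul fun x _ y hy => by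
      rw [dist_eq_norm, dist_eq_norm, Real.coe_toNNReal _ (by positivity)]; exact hL₁ y hy x
  have hlip₂ : LipschitzOnWith (Real.toNNReal (6 * K)) s₂ C :=
    LipschitzOnWith.of_dist_le_mul fun x _ y hy => by
      rw [dist_eq_norm, dist_eq_norm, Real.coe_toNNReal _ (by positivity)]; exact hL₂ y hy x
  -- Hausdorff measure of full dimension is a Haar measure and also obeys the Lipschitz image bound.
  set μ : Measure E := Measure.hausdorffMeasure (Module.finrank ℝ E) with hμ
  have hpos : μ C ≠ 0 := by
    intro h0
    have himg := (hlip₁.add hlip₂).hausdorffMeasure_image_le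
      (d := (Module.finrank ℝ E : ℝ)) (by positivity)
    rw [← hμ, h0, mul_zero] at himg
    have hsub : closedBall (0 : E) δ ⊆ (fun x => s₁ x + s₂ x) '' C := by
      intro p hp
      have hp' : ‖p‖ ≤ δ := by simpa using hp
      obtain ⟨z, hz⟩ := hmax p hp'
      have e := huniq z p hz
      exact ⟨z, ⟨by rw [← e]; exact hp', by rw [← e]; exact hz⟩, e.symm⟩
    have := (measure_closedBall_pos μ (0 : E) hδ).trans_le ((measure_mono hsub).trans himg)
    exact lt_irrefl _ this
  -- Rademacher's theorem within `C` and Lebesgue density both hold almost everywhere on a set of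
  -- positive measure.
  have hae : ∃ z ∈ C, DifferentiableWithinAt ℝ s₁ C z ∧ DifferentiableWithinAt ℝ s₂ C z ∧
      Tendsto (fun r => μ (C ∩ closedBall z r) / μ (closedBall z r)) (𝓝[>] 0) (𝓝 1) := by
    have hne : (ae (μ.restrict C)).NeBot := by
      rw [ae_neBot, Ne, Measure.restrict_eq_zero]; exact hpos
    have hm := hclosed.measurableSet
    obtain ⟨z, hz⟩ := (((hlip₁.ae_differentiableWithinAt (μ := μ) hm).and
      ((hlip₂.ae_differentiableWithinAt (μ := μ) hm).and
      ((Besicovitch.ae_tendsto_measure_inter_div μ C).and (ae_restrict_mem hm))))).exists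
    exact ⟨z, hz.2.2.2, hz.1, hz.2.1, hz.2.2.1⟩
  obtain ⟨z, hzC, hd₁, hd₂, hdens⟩ := hae
  have hden := fun η (hη : 0 < η) =>
    eventually_exists_mem_norm_sub_le_of_density μ hzC hdens hη
  have hA₁ := hasFDerivAt_of_hasFDerivWithinAt_of_density hd₁.hasFDerivWithinAt hden hL₁
  have hA₂ := hasFDerivAt_of_hasFDerivWithinAt_of_density hd₂.hasFDerivWithinAt hden hL₂
  refine ⟨z, _, _, hzC.1, hzC.2, hA₁, hA₂,
    hA₁.le_of_lip' (by positivity) (Eventually.of_forall (hL₁ z hzC)),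
    hA₂.le_of_lip' (by positivity) (Eventually.of_forall (hL₂ z hzC)), fun h => ?_⟩
  refine le_of_forall_pos_le_add fun ε hε => ?_
  set ε' := ε / (4 * (‖h‖ ^ 2 + 1)) with hε'
  have hε'pos : 0 < ε' := by positivity
  have ht := ((h₁.taylor hA₁ hε'pos).and (h₂.taylor hA₂ hε'pos))
  have hcont : Tendsto (fun t : ℝ => t • h) (𝓝[>] 0) (𝓝 0) := by
    have : Tendsto (fun t : ℝ => t • h) (𝓝 0) (𝓝 ((0 : ℝ) • h)) :=
      (continuous_id.smul continuous_const).tendsto 0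
    rw [zero_smul] at this
    exact this.mono_left nhdsWithin_le_nhds
  obtain ⟨t, ⟨ht1, ht2⟩, ht0⟩ := ((hcont.eventually ht).and self_mem_nhdsWithin).exists
  replace ht0 : 0 < t := ht0
  have hz := hzC.2 (z + t • h)
  rw [add_sub_cancel_left, inner_add_left] at hz
  have b1 := (abs_le.1 ht1).1
  have b2 := (abs_le.1 ht2).1
  rw [map_smul, real_inner_smul_left, inner_smul_right, inner_smul_right, norm_smul, mul_pow,
    Real.norm_eq_abs, sq_abs] at b1 b2
  rw [inner_smul_right, inner_smul_right] at hz
  set X := inner ℝ ((fderivWithin ℝ s₁ C z) h) h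
  set Y := inner ℝ ((fderivWithin ℝ s₂ C z) h) h
  have h6 : t ^ 2 * (X + Y) ≤ t ^ 2 * (4 * (ε' * ‖h‖ ^ 2)) := by nlinarith
  have h7 := le_of_mul_le_mul_left h6 (by positivity)
  have h8 : 4 * (ε' * ‖h‖ ^ 2) ≤ ε := by
    rw [hε']
    have : 4 * (ε / (4 * (‖h‖ ^ 2 + 1)) * ‖h‖ ^ 2) = ε * (‖h‖ ^ 2 / (‖h‖ ^ 2 + 1)) := by
      field_simp
    rw [this]
    have h9 : ‖h‖ ^ 2 / (‖h‖ ^ 2 + 1) ≤ 1 := by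
      rw [div_le_one (by positivity)]; linarith
    nlinarith
  linarith

end Semiconvex

/-! ### Ordered eigenvalues and the projections `gammaMat`. -/

section Eigenvalues

open Matrix

variable {n : ℕ}

theorem exists_orthonormalBasis_eigenvalueVec {A : Matrix (Fin n) (Fin n) ℝ}
    (hA : A.IsHermitian) :
    ∃ b : OrthonormalBasis (Fin n) ℝ (EuclideanSpace ℝ (Fin n)),
      ∀ j, A *ᵥ (b j).ofLp = eigenvalueVec A j • (b j).ofLp := by
  classical
  refine ⟨hA.eigenvectorBasis, fun j => ?_⟩
  rw [hA.mulVec_eigenvectorBasis j]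
  congr 1
  rw [eigenvalueVec, dif_pos hA]

/-- The ordering `e` is the same for all matrices, so eigenvalue vectors can be compared index by
index without permutations. -/
theorem exists_equiv_eigenvalueVec_antitone (n : ℕ) :
    ∃ e : Fin n ≃ Fin (Fintype.card (Fin n)), ∀ A : Matrix (Fin n) (Fin n) ℝ, ∀ i j,
      e i ≤ e j → eigenvalueVec A j ≤ eigenvalueVec A i := by
  classical
  refine ⟨(Fintype.equivOfCardEq (Fintype.card_fin _)).symm, fun A i j hij => ?_⟩
  by_cases hA : A.IsHermitian
  · rw [eigenvalueVec, dif_pos hA]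
    exact hA.eigenvalues₀_antitone hij
  · rw [eigenvalueVec, dif_neg hA]
    exact le_rfl

theorem exists_unit_eigenvector {A : Matrix (Fin n) (Fin n) ℝ} (hA : A.IsHermitian) (i : Fin n) :
    ∃ h : Fin n → ℝ, h ⬝ᵥ h = 1 ∧ A *ᵥ h = eigenvalueVec A i • h := by
  obtain ⟨b, hb⟩ := exists_orthonormalBasis_eigenvalueVec hA
  refine ⟨(b i).ofLp, ?_, hb i⟩
  have h1 : inner ℝ (b i) (b i) = (1 : ℝ) := by
    rw [real_inner_self_eq_norm_sq, b.norm_eq_one]; norm_num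
  rw [← h1, EuclideanSpace.inner_eq_star_dotProduct]
  simp

theorem dotProduct_mulVec_eq_sum {A : Matrix (Fin n) (Fin n) ℝ} (hA : A.IsHermitian)
    {b : OrthonormalBasis (Fin n) ℝ (EuclideanSpace ℝ (Fin n))} {κ : Fin n → ℝ}
    (hb : ∀ j, A *ᵥ (b j).ofLp = κ j • (b j).ofLp) (h : EuclideanSpace ℝ (Fin n)) :
    h.ofLp ⬝ᵥ A *ᵥ h.ofLp = ∑ j, κ j * inner ℝ (b j) h ^ 2 := by
  have hAt : Aᵀ = A := by rwa [IsHermitian, conjTranspose_eq_transpose_of_trivial] at hA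
  have e1 : h.ofLp ⬝ᵥ A *ᵥ h.ofLp = inner ℝ h (WithLp.toLp 2 (A *ᵥ h.ofLp)) := by
    rw [EuclideanSpace.inner_eq_star_dotProduct]
    simp [dotProduct_comm]
  rw [e1, ← b.sum_inner_mul_inner]
  refine Finset.sum_congr rfl fun j _ => ?_
  have e2 : inner ℝ (b j) (WithLp.toLp 2 (A *ᵥ h.ofLp)) = κ j * inner ℝ (b j) h := by
    rw [EuclideanSpace.inner_eq_star_dotProduct, EuclideanSpace.inner_eq_star_dotProduct]
    simp only [star_trivial]
    rw [dotProduct_comm, dotProduct_mulVec, ← mulVec_transpose, hAt, hb, smul_dotProduct,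
      smul_eq_mul, dotProduct_comm]
  rw [e2, real_inner_comm]; ring

/-- Weyl's monotonicity principle for the ordered eigenvalues. -/
theorem eigenvalueVec_le_of_form_le {A B : Matrix (Fin n) (Fin n) ℝ} (hA : A.IsHermitian)
    (hB : B.IsHermitian) {c t : ℝ} (hc : 0 ≤ c)
    (hAB : ∀ h : Fin n → ℝ, c * (h ⬝ᵥ A *ᵥ h) ≤ h ⬝ᵥ B *ᵥ h + t * (h ⬝ᵥ h)) (i : Fin n) :
    c * eigenvalueVec A i ≤ eigenvalueVec B i + t := by
  obtain ⟨a, ha⟩ := exists_orthonormalBasis_eigenvalueVec hA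
  obtain ⟨b, hb⟩ := exists_orthonormalBasis_eigenvalueVec hB
  obtain ⟨e, he⟩ := exists_equiv_eigenvalueVec_antitone n
  -- Only `n - 1` conditions are imposed: orthogonality to the eigenvectors of `A` after position
  -- `i` and to those of `B` before it. A nonzero solution `h` separates the two `i`-th eigenvalues.
  let T : EuclideanSpace ℝ (Fin n) →ₗ[ℝ] ({j : Fin n // j ≠ i} → ℝ) :=
    LinearMap.pi fun j => if e i < e j then (innerSL ℝ (a j)).toLinearMap
      else (innerSL ℝ (b j)).toLinearMap
  have hker : LinearMap.ker T ≠ ⊥ := by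
    apply LinearMap.ker_ne_bot_of_finrank_lt
    rw [Module.finrank_fintype_fun_eq_card, finrank_euclideanSpace]
    exact Fintype.card_subtype_lt (x := i) (by simp)
  obtain ⟨h, hh, hne⟩ := (Submodule.ne_bot_iff _).1 hker
  have hT : ∀ j, j ≠ i → (if e i < e j then inner ℝ (a j) h else inner ℝ (b j) h) = (0 : ℝ) := by
    intro j hj
    have := congrFun (LinearMap.mem_ker.1 hh) ⟨j, hj⟩
    simp only [T, LinearMap.pi_apply, Pi.zero_apply] at this
    split_ifs at this ⊢ <;> simpa using this
  have hn2 : h.ofLp ⬝ᵥ h.ofLp = ‖h‖ ^ 2 := by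
    rw [← real_inner_self_eq_norm_sq, EuclideanSpace.inner_eq_star_dotProduct]; simp
  have hlow : eigenvalueVec A i * ‖h‖ ^ 2 ≤ h.ofLp ⬝ᵥ A *ᵥ h.ofLp := by
    rw [dotProduct_mulVec_eq_sum hA ha, ← a.sum_sq_norm_inner_right h, Finset.mul_sum]
    refine Finset.sum_le_sum fun j _ => ?_
    rw [Real.norm_eq_abs, sq_abs]
    by_cases hij : e i < e j
    · have h0 := hT j (fun hji => by rw [hji] at hij; exact lt_irrefl _ hij)
      rw [if_pos hij] at h0
      rw [h0]; simp
    · exact mul_le_mul_of_nonneg_right (he A j i (not_lt.1 hij)) (sq_nonneg _)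
  have hup : h.ofLp ⬝ᵥ B *ᵥ h.ofLp ≤ eigenvalueVec B i * ‖h‖ ^ 2 := by
    rw [dotProduct_mulVec_eq_sum hB hb, ← b.sum_sq_norm_inner_right h, Finset.mul_sum]
    refine Finset.sum_le_sum fun j _ => ?_
    rw [Real.norm_eq_abs, sq_abs]
    by_cases hji : j = i
    · rw [hji]
    by_cases hij : e i < e j
    · exact mul_le_mul_of_nonneg_right (he B i j hij.le) (sq_nonneg _)
    · have h0 := hT j hji
      rw [if_neg hij] at h0
      rw [h0]; simp
  have hpos : 0 < ‖h‖ ^ 2 := by positivity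
  have := hAB h.ofLp
  rw [hn2] at this
  refine le_of_mul_le_mul_right ?_ hpos
  nlinarith

theorem abs_dotProduct_mulVec_le (A : Matrix (Fin n) (Fin n) ℝ) (h : Fin n → ℝ) :
    |h ⬝ᵥ A *ᵥ h| ≤ (∑ i, ∑ j, |A i j|) * (h ⬝ᵥ h) := by
  have hsq : ∀ i, h i ^ 2 ≤ h ⬝ᵥ h := fun i => by
    rw [dotProduct, pow_two]
    exact Finset.single_le_sum (f := fun i => h i * h i) (fun j _ => mul_self_nonneg _)
      (Finset.mem_univ i)
  have hij : ∀ i j, |h i * h j| ≤ h ⬝ᵥ h := fun i j => by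
    rw [abs_le]; constructor <;> nlinarith [hsq i, hsq j, sq_nonneg (h i + h j),
      sq_nonneg (h i - h j)]
  have e : h ⬝ᵥ A *ᵥ h = ∑ i, ∑ j, A i j * (h i * h j) := by
    simp only [dotProduct, mulVec, Finset.mul_sum]
    exact Finset.sum_congr rfl fun i _ => Finset.sum_congr rfl fun j _ => by ring
  rw [e, Finset.sum_mul]
  refine (Finset.abs_sum_le_sum_abs _ _).trans (Finset.sum_le_sum fun i _ => ?_)
  rw [Finset.sum_mul]
  refine (Finset.abs_sum_le_sum_abs _ _).trans (Finset.sum_le_sum fun j _ => ?_)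
  rw [abs_mul]
  exact mul_le_mul_of_nonneg_left (hij i j) (abs_nonneg _)

theorem tendsto_eigenvalueVec {α : Type*} {l : Filter α} {A : α → Matrix (Fin n) (Fin n) ℝ}
    {B : Matrix (Fin n) (Fin n) ℝ} (hA : ∀ k, (A k).IsHermitian) (hB : B.IsHermitian)
    (hlim : Tendsto A l (𝓝 B)) :
    Tendsto (fun k => eigenvalueVec (A k)) l (𝓝 (eigenvalueVec B)) := by
  have hd : Tendsto (fun k => ∑ i, ∑ j, |(A k - B) i j|) l (𝓝 0) := by
    have hc : Continuous fun M : Matrix (Fin n) (Fin n) ℝ => ∑ i, ∑ j, |(M - B) i j| := by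
      fun_prop
    have := (hc.tendsto B).comp hlim
    simpa [Function.comp_def] using this
  rw [tendsto_pi_nhds]
  intro i
  rw [tendsto_iff_norm_sub_tendsto_zero]
  refine squeeze_zero (fun _ => norm_nonneg _) (fun k => ?_) hd
  have key : ∀ h : Fin n → ℝ, |h ⬝ᵥ A k *ᵥ h - h ⬝ᵥ B *ᵥ h|
      ≤ (∑ i, ∑ j, |(A k - B) i j|) * (h ⬝ᵥ h) := fun h => by
    have := abs_dotProduct_mulVec_le (A k - B) h
    rwa [sub_mulVec, dotProduct_sub] at this
  have h1 := eigenvalueVec_le_of_form_le (hA k) hB (c := 1) zero_le_one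
    (t := ∑ i, ∑ j, |(A k - B) i j|) (fun h => by have := (abs_le.1 (key h)).2; linarith) i
  have h2 := eigenvalueVec_le_of_form_le hB (hA k) (c := 1) zero_le_one
    (t := ∑ i, ∑ j, |(A k - B) i j|) (fun h => by have := (abs_le.1 (key h)).1; linarith) i
  rw [Real.norm_eq_abs, abs_le]
  constructor <;> linarith

theorem eigenvalueVec_mono {A B : Matrix (Fin n) (Fin n) ℝ} (hA : A.IsHermitian)
    (hB : B.IsHermitian) (hAB : ∀ h : Fin n → ℝ, h ⬝ᵥ A *ᵥ h ≤ h ⬝ᵥ B *ᵥ h) (i : Fin n) :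
    eigenvalueVec A i ≤ eigenvalueVec B i := by
  have := eigenvalueVec_le_of_form_le hA hB (c := 1) (t := 0) zero_le_one
    (fun h => by have := hAB h; linarith) i
  linarith

theorem eigenvalueVec_smul {A : Matrix (Fin n) (Fin n) ℝ} (hA : A.IsHermitian) {c : ℝ}
    (hc : 0 < c) : eigenvalueVec (c • A) = c • eigenvalueVec A := by
  have hcA : (c • A).IsHermitian := hA.smul (by simp [IsSelfAdjoint])
  funext i
  refine le_antisymm ?_ ?_
  · have := eigenvalueVec_le_of_form_le hcA hA (c := c⁻¹) (t := 0) (by positivity)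
      (fun h => by
        rw [smul_mulVec, dotProduct_smul, smul_eq_mul, inv_mul_cancel_left₀ hc.ne']; linarith) i
    rw [add_zero, inv_mul_le_iff₀ hc] at this
    simpa using this
  · have := eigenvalueVec_le_of_form_le hA hcA (c := c) (t := 0) hc.le
      (fun h => by rw [smul_mulVec, dotProduct_smul, smul_eq_mul]; linarith) i
    simpa using this

theorem eigenvalueVec_smul_one (c : ℝ) (i : Fin n) :
    eigenvalueVec (c • (1 : Matrix (Fin n) (Fin n) ℝ)) i = c := by
  have hc : (c • (1 : Matrix (Fin n) (Fin n) ℝ)).IsHermitian :=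
    isHermitian_one.smul (by simp [IsSelfAdjoint])
  obtain ⟨h, h1, h2⟩ := exists_unit_eigenvector hc i
  have := congrArg (fun x => h ⬝ᵥ x) h2
  simp only [smul_mulVec, one_mulVec, dotProduct_smul, h1, smul_eq_mul, mul_one] at this
  exact this.symm

theorem isHermitian_gammaMat (η : EuclideanSpace ℝ (Fin n)) : (gammaMat η).IsHermitian := by
  rw [IsHermitian, conjTranspose_eq_transpose_of_trivial]
  ext i j
  simp [gammaMat, eq_comm, mul_comm]

theorem gammaMat_mulVec (η : EuclideanSpace ℝ (Fin n)) (h : Fin n → ℝ) :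
    gammaMat η *ᵥ h = h - (η.ofLp ⬝ᵥ h) • η.ofLp := by
  have : gammaMat η = 1 - vecMulVec η.ofLp η.ofLp := by
    ext i j; simp [gammaMat, vecMulVec, one_apply]
  rw [this, sub_mulVec, one_mulVec, vecMulVec_mulVec]
  simp

theorem ofLp_dotProduct_self (η : EuclideanSpace ℝ (Fin n)) : η.ofLp ⬝ᵥ η.ofLp = ‖η‖ ^ 2 := by
  rw [← real_inner_self_eq_norm_sq, EuclideanSpace.inner_eq_star_dotProduct]; simp

theorem gammaMat_mulVec_gammaMat {η : EuclideanSpace ℝ (Fin n)} (hη : ‖η‖ = 1) (h : Fin n → ℝ) :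
    gammaMat η *ᵥ gammaMat η *ᵥ h = gammaMat η *ᵥ h := by
  simp only [gammaMat_mulVec, dotProduct_sub, dotProduct_smul, ofLp_dotProduct_self, hη]
  simp

theorem gammaMat_mul_self {η : EuclideanSpace ℝ (Fin n)} (hη : ‖η‖ = 1) :
    gammaMat η * gammaMat η = gammaMat η := by
  refine ext_of_mulVec_single fun i => ?_
  rw [← mulVec_mulVec, gammaMat_mulVec_gammaMat hη]

theorem isHermitian_gammaMat_conj {X : Matrix (Fin n) (Fin n) ℝ} (hX : X.IsHermitian)
    (η : EuclideanSpace ℝ (Fin n)) : (gammaMat η * X * gammaMat η).IsHermitian := by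
  have := isHermitian_conjTranspose_mul_mul (gammaMat η) hX
  rwa [(isHermitian_gammaMat η).eq] at this

theorem dotProduct_gammaMat_mulVec (η : EuclideanSpace ℝ (Fin n)) (h k : Fin n → ℝ) :
    h ⬝ᵥ gammaMat η *ᵥ k = (gammaMat η *ᵥ h) ⬝ᵥ k := by
  have hs : (gammaMat η)ᵀ = gammaMat η := by
    have := (isHermitian_gammaMat η).eq
    rwa [conjTranspose_eq_transpose_of_trivial] at this
  rw [dotProduct_mulVec, ← mulVec_transpose, hs]

theorem dotProduct_gammaMat_conj (X : Matrix (Fin n) (Fin n) ℝ) (η : EuclideanSpace ℝ (Fin n))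
    (h : Fin n → ℝ) :
    h ⬝ᵥ (gammaMat η * X * gammaMat η) *ᵥ h = (gammaMat η *ᵥ h) ⬝ᵥ X *ᵥ (gammaMat η *ᵥ h) := by
  rw [← mulVec_mulVec, ← mulVec_mulVec, dotProduct_gammaMat_mulVec]

theorem gammaMat_mulVec_dotProduct_self_le {η : EuclideanSpace ℝ (Fin n)} (hη : ‖η‖ ≤ 1)
    (h : Fin n → ℝ) : (gammaMat η *ᵥ h) ⬝ᵥ (gammaMat η *ᵥ h) ≤ h ⬝ᵥ h := by
  simp only [gammaMat_mulVec, dotProduct_sub, sub_dotProduct, dotProduct_smul, smul_dotProduct,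
    ofLp_dotProduct_self, smul_eq_mul, dotProduct_comm h]
  have : ‖η‖ ^ 2 ≤ 1 := by nlinarith [norm_nonneg η]
  nlinarith [mul_nonneg (sq_nonneg (η.ofLp ⬝ᵥ h)) (sub_nonneg.2 this),
    sq_nonneg (η.ofLp ⬝ᵥ h)]

theorem continuous_gammaMat : Continuous (gammaMat (n := n)) := by
  unfold gammaMat
  refine continuous_matrix fun i j => ?_
  simp only [of_apply]
  fun_prop

/-- The projection orthogonal to a unit vector has the eigenvalue zero once and the eigenvalue one
otherwise. -/
theorem exists_eigenvalueVec_gammaMat {η : EuclideanSpace ℝ (Fin n)} (hη : ‖η‖ = 1) :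
    ∃ j, eigenvalueVec (gammaMat η) j = 0 ∧
      ∀ i, i ≠ j → eigenvalueVec (gammaMat η) i = 1 := by
  classical
  have hG := isHermitian_gammaMat η
  -- Idempotence restricts the spectrum to 0 and 1; the trace `n - 1` then counts the zeros.
  have h01 : ∀ i, eigenvalueVec (gammaMat η) i = 0 ∨ eigenvalueVec (gammaMat η) i = 1 := by
    intro i
    obtain ⟨h, h1, h2⟩ := exists_unit_eigenvector hG i
    have h3 := gammaMat_mulVec_gammaMat hη h
    rw [h2, mulVec_smul, h2, smul_smul] at h3
    have h4 := congrArg (fun x => h ⬝ᵥ x) h3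
    simp only [dotProduct_smul, h1, smul_eq_mul, mul_one] at h4
    rcases eq_or_ne (eigenvalueVec (gammaMat η) i) 0 with h0 | h0
    · exact Or.inl h0
    · exact Or.inr (mul_left_cancel₀ h0 (by rw [h4, mul_one]))
  have htr : ∑ i, (1 - eigenvalueVec (gammaMat η) i) = 1 := by
    have e1 : ∑ i, eigenvalueVec (gammaMat η) i = trace (gammaMat η) := by
      rw [hG.trace_eq_sum_eigenvalues]
      refine Finset.sum_congr rfl fun i _ => ?_
      rw [eigenvalueVec, dif_pos hG]
      simp only [RCLike.ofReal_real_eq_id, id_eq]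
    have e2 : trace (gammaMat η) = n - 1 := by
      have := ofLp_dotProduct_self η
      rw [hη, one_pow, dotProduct] at this
      simp [trace, gammaMat, this]
    rw [Finset.sum_sub_distrib, e1, e2]
    simp
  have hex : ∃ j, eigenvalueVec (gammaMat η) j ≠ 1 := by
    by_contra hcon
    push Not at hcon
    simp [hcon] at htr
  obtain ⟨j, hj⟩ := hex
  have hj0 := (h01 j).resolve_right hj
  refine ⟨j, hj0, fun i hij => ?_⟩
  by_contra hi
  have hi0 := (h01 i).resolve_right hi
  have hnn : ∀ k, 0 ≤ 1 - eigenvalueVec (gammaMat η) k := fun k => by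
    rcases h01 k with h | h <;> rw [h] <;> norm_num
  have hle : ∑ k ∈ {i, j}, (1 - eigenvalueVec (gammaMat η) k)
      ≤ ∑ k, (1 - eigenvalueVec (gammaMat η) k) :=
    Finset.sum_le_sum_of_subset_of_nonneg (Finset.subset_univ _) fun k _ _ => hnn k
  rw [Finset.sum_pair hij, htr, hi0, hj0] at hle
  norm_num at hle

end Eigenvalues

/-! ### The cone `K` and the function `f`: monotonicity and shifts into the cone. -/

namespace IsCurvatureFunction

variable {n : ℕ} {K : Set (Fin n → ℝ)} {f : (Fin n → ℝ) → ℝ} (hf : IsCurvatureFunction K f)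
include hf

theorem smul_mem_closure {κ : Fin n → ℝ} (hκ : κ ∈ closure K) {t : ℝ} (ht : 0 < t) :
    t • κ ∈ closure K :=
  map_mem_closure (f := fun x => t • x) (continuous_const_smul t) hκ
    fun x hx => hf.cone x hx t ht

theorem add_mem {a b : Fin n → ℝ} (ha : a ∈ K) (hb : b ∈ closure K) : a + b ∈ K := by
  have h1 : (1 / 2 : ℝ) • a + (1 / 2 : ℝ) • b ∈ interior K :=
    hf.convex.combo_interior_closure_mem_interior (by rwa [hf.isOpen.interior_eq]) hb
      (by norm_num) (by norm_num) (by norm_num)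
  rw [hf.isOpen.interior_eq] at h1
  have h2 := hf.cone _ h1 2 (by norm_num)
  rwa [smul_add, smul_smul, smul_smul, show (2 : ℝ) * (1 / 2) = 1 by norm_num, one_smul,
    one_smul] at h2

theorem mem_closure_of_nonneg {κ : Fin n → ℝ} (hκ : ∀ i, 0 ≤ κ i) : κ ∈ closure K :=
  hf.orthant_ssubset.subset hκ

theorem mem_of_pos {κ : Fin n → ℝ} (hκ : ∀ i, 0 < κ i) : κ ∈ K := by
  have hne : K.Nonempty := closure_nonempty_iff.1 ⟨0, hf.mem_closure_of_nonneg fun _ => le_rfl⟩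
  have h1 : interior (closure K) = interior K :=
    hf.convex.interior_closure_eq_interior_of_nonempty_interior
      (by rwa [hf.isOpen.interior_eq])
  rw [hf.isOpen.interior_eq] at h1
  rw [← h1, mem_interior]
  refine ⟨Set.univ.pi fun _ => Ioi 0, fun x hx => ?_, isOpen_set_pi finite_univ
    fun _ _ => isOpen_Ioi, fun i _ => hκ i⟩
  exact hf.mem_closure_of_nonneg fun i => (hx i trivial).le

/-- Strictness of the orthant inclusion enters here. By symmetry `closure K` has a vector `b` with
negative `j`-th entry; for small `ε`, `κ - ε • b` is positive and adding `ε • b` back stays in `K`.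
This puts the spectrum of a projection, which contains a zero, in the open cone. -/
theorem mem_of_nonneg_of_pos {κ : Fin n → ℝ} {j : Fin n} (hj : 0 ≤ κ j)
    (hκ : ∀ i, i ≠ j → 0 < κ i) : κ ∈ K := by
  obtain ⟨a, ha, hna⟩ := Set.exists_of_ssubset hf.orthant_ssubset
  simp only [mem_ofPred_eq, not_forall, not_le] at hna
  obtain ⟨k, hk⟩ := hna
  have ha' : a ∘ Equiv.swap j k ∈ closure K :=
    map_mem_closure (f := fun x : Fin n → ℝ => x ∘ Equiv.swap j k)
      (continuous_pi fun i => continuous_apply _) ha fun x hx => hf.symm_cone x hx _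
  set b := a ∘ Equiv.swap j k with hb
  have hbj : b j < 0 := by simpa [hb] using hk
  have hev : ∀ᶠ ε in 𝓝[>] (0 : ℝ), ∀ i, 0 < κ i - ε * b i := by
    rw [eventually_all]
    intro i
    by_cases hij : i = j
    · filter_upwards [self_mem_nhdsWithin] with ε hε
      have : 0 < ε * (-b j) := mul_pos hε (by linarith)
      rw [hij]; linarith
    · have hc : Tendsto (fun ε : ℝ => κ i - ε * b i) (𝓝 0) (𝓝 (κ i - 0 * b i)) :=
        (continuous_const.sub (continuous_id.mul continuous_const)).tendsto 0
      rw [zero_mul, sub_zero] at hc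
      exact (hc.mono_left nhdsWithin_le_nhds).eventually (lt_mem_nhds (hκ i hij))
  obtain ⟨ε, hε, hε0⟩ := (hev.and self_mem_nhdsWithin).exists
  have h1 : (κ - ε • b) ∈ K := hf.mem_of_pos fun i => by simpa using hε i
  have := hf.add_mem h1 (hf.smul_mem_closure ha' hε0)
  rwa [sub_add_cancel] at this

theorem mem_of_le {κ κ' : Fin n → ℝ} (hκ : κ ∈ K) (h : ∀ i, κ i ≤ κ' i) : κ' ∈ K := by
  have := hf.add_mem hκ (hf.mem_closure_of_nonneg (κ := κ' - κ) fun i => by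
    simpa using h i)
  rwa [add_sub_cancel] at this

theorem add_le {a b : Fin n → ℝ} (ha : a ∈ K) (hb : b ∈ K) : f a + f b ≤ f (a + b) := by
  have h1 := hf.concave.2 ha hb (show (0 : ℝ) ≤ 1 / 2 by norm_num)
    (show (0 : ℝ) ≤ 1 / 2 by norm_num) (by norm_num)
  have hm : (1 / 2 : ℝ) • a + (1 / 2 : ℝ) • b ∈ K :=
    hf.convex ha hb (by norm_num) (by norm_num) (by norm_num)
  have h2 := hf.homogeneous _ hm 2 (by norm_num)
  rw [smul_add, smul_smul, smul_smul, show (2 : ℝ) * (1 / 2) = 1 by norm_num, one_smul,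
    one_smul] at h2
  simp only [smul_eq_mul] at h1
  linarith

theorem tendsto_add_smul_one (κ : Fin n → ℝ) (hκ : κ ∈ closure K) :
    Tendsto (fun t : ℝ => f (κ + t • fun _ => 1)) (𝓝[>] 0) (𝓝 (f κ)) := by
  have hc : Tendsto (fun t : ℝ => κ + t • (fun _ => 1 : Fin n → ℝ)) (𝓝 0)
      (𝓝 (κ + (0 : ℝ) • fun _ => 1)) :=
    (continuous_const.add (continuous_id.smul continuous_const)).tendsto 0
  rw [zero_smul, add_zero] at hc
  refine (hf.continuousOn κ hκ).tendsto.comp (tendsto_nhdsWithin_iff.2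
    ⟨hc.mono_left nhdsWithin_le_nhds, ?_⟩)
  filter_upwards [self_mem_nhdsWithin] with t ht
  rw [add_comm]
  exact subset_closure (hf.add_mem (hf.mem_of_pos fun i => by simpa using ht) hκ)

/-- Concavity and homogeneity make `f` superadditive on `K`, and `f` is positive there. Adding small
multiples of `(1, …, 1)` brings the boundary case into `K`. -/
theorem mono {κ κ' : Fin n → ℝ} (hκ : κ ∈ closure K) (h : ∀ i, κ i ≤ κ' i) : f κ ≤ f κ' := by
  have hκ' : κ' ∈ closure K := by
    have h1 := map_mem_closure (f := fun x : Fin n → ℝ => x + (κ' - κ)) (t := K)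
      (continuous_id.add continuous_const) hκ
      fun x hx => hf.add_mem hx (hf.mem_closure_of_nonneg fun i => by simpa using h i)
    rwa [add_sub_cancel] at h1
  have ht2 : Tendsto (fun t : ℝ => 2 * t) (𝓝[>] 0) (𝓝[>] 0) := by
    refine tendsto_nhdsWithin_iff.2 ⟨?_, ?_⟩
    · have : Tendsto (fun t : ℝ => 2 * t) (𝓝 0) (𝓝 (2 * 0)) :=
        (continuous_const.mul continuous_id).tendsto 0
      rw [mul_zero] at this
      exact this.mono_left nhdsWithin_le_nhds
    · filter_upwards [self_mem_nhdsWithin] with t ht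
      have : (0 : ℝ) < t := ht
      show (0 : ℝ) < 2 * t
      linarith
  refine le_of_tendsto_of_tendsto (hf.tendsto_add_smul_one κ hκ)
    ((hf.tendsto_add_smul_one κ' hκ').comp ht2) ?_
  filter_upwards [self_mem_nhdsWithin] with t ht
  replace ht : (0 : ℝ) < t := ht
  have h1 : κ + t • (fun _ => 1 : Fin n → ℝ) ∈ K := by
    rw [add_comm]
    exact hf.add_mem (hf.mem_of_pos fun i => by simpa using ht) hκ
  have h2 : (κ' - κ) + t • (fun _ => 1 : Fin n → ℝ) ∈ K :=
    hf.mem_of_pos fun i => by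
      have := h i
      simp only [Pi.add_apply, Pi.sub_apply, Pi.smul_apply, smul_eq_mul, mul_one]
      linarith
  have h3 := hf.add_le h1 h2
  have h4 := hf.pos _ h2
  have e : κ + t • (fun _ => 1 : Fin n → ℝ) + (κ' - κ + t • fun _ => 1)
      = κ' + (2 * t) • fun _ => 1 := by
    ext i; simp; ring
  rw [e] at h3
  simp only [Function.comp]
  linarith

theorem mem_of_apply_pos {κ : Fin n → ℝ} (hκ : κ ∈ closure K) (h : 0 < f κ) : κ ∈ K := by
  by_contra hc
  have : κ ∈ frontier K := ⟨hκ, by rwa [hf.isOpen.interior_eq]⟩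
  rw [hf.eq_zero κ this] at h
  exact lt_irrefl _ h

theorem apply_const {c : ℝ} (hc : 0 < c) : f (fun _ => c) = c := by
  have h1 : (fun _ => 1 : Fin n → ℝ) ∈ K := hf.mem_of_pos fun _ => one_pos
  have := hf.homogeneous _ h1 c hc
  rw [hf.normalized, mul_one] at this
  have e : (c • fun _ => 1 : Fin n → ℝ) = fun _ => c := by
    ext i; simp
  rwa [e] at this

theorem eigenvalueVec_gammaMat_mem {η : EuclideanSpace ℝ (Fin n)} (hη : ‖η‖ = 1) :
    eigenvalueVec (gammaMat η) ∈ K := by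
  obtain ⟨j, hj, hi⟩ := exists_eigenvalueVec_gammaMat hη
  exact hf.mem_of_nonneg_of_pos hj.ge fun i hij => by rw [hi i hij]; exact one_pos

/-- If `F(A) ≥ 1` fails, then `A` can be increased in the direction of `G` to a matrix in the
domain at which `0 < F < 1`. -/
theorem exists_nonneg_shift {A G : Matrix (Fin n) (Fin n) ℝ} (hA : A.IsHermitian)
    (hG : G.IsHermitian) (hlarge : ∃ t : ℝ, 0 ≤ t ∧ eigenvalueVec (A + t • G) ∈ K)
    (hnot : ¬(InDomain K A ∧ 1 ≤ curvF f A)) :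
    ∃ t : ℝ, 0 ≤ t ∧ eigenvalueVec (A + t • G) ∈ K ∧ curvF f (A + t • G) < 1 := by
  by_cases h0 : eigenvalueVec A ∈ K
  · refine ⟨0, le_rfl, by simpa using h0, ?_⟩
    rw [zero_smul, add_zero]
    by_contra hc
    exact hnot ⟨subset_closure h0, not_lt.1 hc⟩
  have hherm : ∀ t : ℝ, (A + t • G).IsHermitian := fun t =>
    hA.add (hG.smul (by simp [IsSelfAdjoint]))
  have hcont : Continuous fun t : ℝ => eigenvalueVec (A + t • G) := by
    rw [continuous_iff_continuousAt]
    intro t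
    have hc : Continuous fun t : ℝ => A + t • G := by fun_prop
    exact tendsto_eigenvalueVec hherm (hherm t) (hc.tendsto t)
  -- At the infimum `τ` of the admissible shifts the spectrum lies on the boundary of `K`, where `f
  -- = 0`. By continuity some shift in `T` near `τ` has `f < 1`.
  set T : Set ℝ := {t | 0 ≤ t ∧ eigenvalueVec (A + t • G) ∈ K} with hT
  have hTne : T.Nonempty := hlarge
  have hTb : BddBelow T := ⟨0, fun t ht => ht.1⟩
  set τ := sInf T with hτ
  have hτ0 : 0 ≤ τ := le_csInf hTne fun t ht => ht.1
  have hτcl : τ ∈ closure T := csInf_mem_closure hTne hTb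
  have hτK : eigenvalueVec (A + τ • G) ∉ K := by
    intro hmem
    have hpos : 0 < τ := by
      refine lt_of_le_of_ne hτ0 fun he => h0 ?_
      rwa [← he, zero_smul, add_zero] at hmem
    have hev := (hcont.tendsto τ).eventually (hf.isOpen.mem_nhds hmem)
    obtain ⟨t, ⟨ht1, ht2⟩, ht3⟩ := (((hev.filter_mono (nhdsWithin_le_nhds (s := Iio τ))).and
      ((lt_mem_nhds hpos).filter_mono nhdsWithin_le_nhds)).and self_mem_nhdsWithin).exists
    exact absurd (csInf_le hTb (show t ∈ T from ⟨ht2.le, ht1⟩)) (not_le.2 ht3)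
  have hτC : eigenvalueVec (A + τ • G) ∈ closure K :=
    map_mem_closure (f := fun t : ℝ => eigenvalueVec (A + t • G)) hcont hτcl fun t ht => ht.2
  have hz : f (eigenvalueVec (A + τ • G)) = 0 :=
    hf.eq_zero _ ⟨hτC, by rwa [hf.isOpen.interior_eq]⟩
  have hlim : Tendsto (fun t : ℝ => f (eigenvalueVec (A + t • G))) (𝓝[T] τ) (𝓝 0) := by
    rw [← hz]
    refine (hf.continuousOn _ hτC).tendsto.comp (tendsto_nhdsWithin_iff.2
      ⟨(hcont.tendsto τ).mono_left nhdsWithin_le_nhds, ?_⟩)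
    filter_upwards [self_mem_nhdsWithin] with t ht using subset_closure ht.2
  have : (𝓝[T] τ).NeBot := mem_closure_iff_nhdsWithin_neBot.1 hτcl
  obtain ⟨t, ht1, ht2⟩ := ((hlim.eventually (gt_mem_nhds one_pos)).and self_mem_nhdsWithin).exists
  exact ⟨t, ht2.1, ht2.2, ht1⟩

-- Adding `t • 1` to `X` adds `t • gammaMat η` after projection. For `t` exceeding the size of `X`
-- by one, the result dominates `gammaMat η`, whose spectrum is in `K`.
open Matrix in
theorem exists_nonneg_shift_gammaMat {X : Matrix (Fin n) (Fin n) ℝ} (hX : X.IsHermitian)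
    {η : EuclideanSpace ℝ (Fin n)} (hη : ‖η‖ = 1)
    (hnot : ¬(InDomain K (gammaMat η * X * gammaMat η) ∧
      1 ≤ curvF f (gammaMat η * X * gammaMat η))) :
    ∃ t : ℝ, 0 ≤ t ∧ eigenvalueVec (gammaMat η * (X + t • 1) * gammaMat η) ∈ K ∧
      curvF f (gammaMat η * (X + t • 1) * gammaMat η) < 1 := by
  have e : ∀ t : ℝ, gammaMat η * (X + t • 1) * gammaMat η
      = gammaMat η * X * gammaMat η + t • gammaMat η := fun t => by
    rw [Matrix.mul_add, Matrix.add_mul, Matrix.mul_smul, Matrix.mul_one, Matrix.smul_mul,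
      gammaMat_mul_self hη]
  simp only [e]
  have hG := isHermitian_gammaMat η
  have hA := isHermitian_gammaMat_conj hX η
  refine hf.exists_nonneg_shift hA hG ?_ hnot
  set M := ∑ i, ∑ j, |X i j| with hM
  have hM0 : 0 ≤ M := Finset.sum_nonneg fun i _ => Finset.sum_nonneg fun j _ => abs_nonneg _
  refine ⟨M + 1, by linarith, hf.mem_of_le (hf.eigenvalueVec_gammaMat_mem hη) ?_⟩
  refine eigenvalueVec_mono hG (hA.add (hG.smul (by simp [IsSelfAdjoint]))) fun h => ?_
  rw [add_mulVec, dotProduct_add, smul_mulVec, dotProduct_smul, dotProduct_gammaMat_conj,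
    smul_eq_mul]
  have h1 := (abs_le.1 (abs_dotProduct_mulVec_le X (gammaMat η *ᵥ h))).1
  have h2 : h ⬝ᵥ gammaMat η *ᵥ h = (gammaMat η *ᵥ h) ⬝ᵥ (gammaMat η *ᵥ h) := by
    conv_lhs => rw [← gammaMat_mulVec_gammaMat hη]
    rw [dotProduct_gammaMat_mulVec]
  rw [h2]
  linarith

end IsCurvatureFunction

/-! ### Quadratic test functions. -/

section QuadraticTest

variable {n : ℕ}

/-- The matrix of the quadratic form `h ↦ ⟪B h, h⟫`. -/
noncomputable def symMatrix (B : EuclideanSpace ℝ (Fin n) →L[ℝ] EuclideanSpace ℝ (Fin n)) :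
    Matrix (Fin n) (Fin n) ℝ :=
  Matrix.of fun i j => 1 / 2 * (inner ℝ (B (EuclideanSpace.single i 1)) (EuclideanSpace.single j 1)
    + inner ℝ (B (EuclideanSpace.single j 1)) (EuclideanSpace.single i 1))

/-- The quadratic polynomial with value `c`, gradient `s` and second order part `⟪B h, h⟫ / 2`
at `a`. -/
noncomputable def quadTest (c : ℝ) (s : EuclideanSpace ℝ (Fin n))
    (B : EuclideanSpace ℝ (Fin n) →L[ℝ] EuclideanSpace ℝ (Fin n)) (a : EuclideanSpace ℝ (Fin n)) :
    EuclideanSpace ℝ (Fin n) → ℝ :=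
  fun x => c + inner ℝ s (x - a) + 1 / 2 * inner ℝ (B (x - a)) (x - a)

variable (c : ℝ) (s : EuclideanSpace ℝ (Fin n))
  (B : EuclideanSpace ℝ (Fin n) →L[ℝ] EuclideanSpace ℝ (Fin n)) (a x : EuclideanSpace ℝ (Fin n))

theorem isHermitian_symMatrix : (symMatrix B).IsHermitian := by
  rw [Matrix.IsHermitian, Matrix.conjTranspose_eq_transpose_of_trivial]
  ext i j
  simp [symMatrix, add_comm]

-- The operator `B` need not be self-adjoint; symmetrizing preserves its quadratic form, which is
-- all that touching and eigenvalue comparison use.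
open Matrix in
theorem dotProduct_symMatrix_mulVec (h : EuclideanSpace ℝ (Fin n)) :
    h.ofLp ⬝ᵥ symMatrix B *ᵥ h.ofLp = inner ℝ (B h) h := by
  have hh : h = ∑ i, h i • EuclideanSpace.single i (1 : ℝ) := by
    simpa using ((EuclideanSpace.basisFun (Fin n) ℝ).sum_repr h).symm
  have e : inner ℝ (B h) h = ∑ i, ∑ j, h i * h j *
      inner ℝ (B (EuclideanSpace.single i 1)) (EuclideanSpace.single j (1 : ℝ)) := by
    have e0 : inner ℝ (B h) h = inner ℝ (B (∑ i, h i • EuclideanSpace.single i (1 : ℝ)))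
        (∑ i, h i • EuclideanSpace.single i (1 : ℝ)) := by rw [← hh]
    rw [e0]
    simp only [map_sum, map_smul, sum_inner, inner_sum, real_inner_smul_left, inner_smul_right,
      Finset.mul_sum]
    rw [Finset.sum_comm]
    refine Finset.sum_congr rfl fun i _ => ?_
    refine Finset.sum_congr rfl fun j _ => ?_
    ring
  have e2 : inner ℝ (B h) h = ∑ i, ∑ j, h i * h j *
      inner ℝ (B (EuclideanSpace.single j 1)) (EuclideanSpace.single i (1 : ℝ)) := by
    rw [e, Finset.sum_comm]
    exact Finset.sum_congr rfl fun i _ => Finset.sum_congr rfl fun j _ => by ring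
  have e3 : h.ofLp ⬝ᵥ symMatrix B *ᵥ h.ofLp
      = 1 / 2 * inner ℝ (B h) h + 1 / 2 * inner ℝ (B h) h := by
    nth_rewrite 1 [e]
    rw [e2]
    simp only [dotProduct, mulVec, symMatrix, of_apply, Finset.mul_sum, ← Finset.sum_add_distrib]
    exact Finset.sum_congr rfl fun i _ => Finset.sum_congr rfl fun j _ => by ring
  rw [e3]; ring

theorem symMatrix_add_smul_id (t : ℝ) :
    symMatrix (B + t • ContinuousLinearMap.id ℝ _) = symMatrix B + t • 1 := by
  ext i j
  simp only [symMatrix, _root_.add_apply, _root_.smul_apply,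
    ContinuousLinearMap.id_apply, inner_add_left, real_inner_smul_left, Matrix.add_apply,
    Matrix.smul_apply, Matrix.of_apply, smul_eq_mul, EuclideanSpace.inner_single_left,
    PiLp.single_apply, Matrix.one_apply, map_one, one_mul]
  by_cases h : i = j
  · subst h; simp; ring
  · simp [h, Ne.symm h]

theorem symMatrix_smul (t : ℝ) : symMatrix (t • B) = t • symMatrix B := by
  ext i j
  simp only [symMatrix, _root_.smul_apply, real_inner_smul_left, Matrix.smul_apply,
    Matrix.of_apply, smul_eq_mul]
  ring

theorem continuous_symMatrix : Continuous (symMatrix (n := n)) := by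
  unfold symMatrix
  refine continuous_matrix fun i j => ?_
  simp only [Matrix.of_apply]
  fun_prop

/-- The gradient of `quadTest c s B a`. -/
noncomputable def quadGrad : EuclideanSpace ℝ (Fin n) :=
  s + (1 / 2 : ℝ) • (B + ContinuousLinearMap.adjoint B) (x - a)

theorem hasFDerivAt_quadTest :
    HasFDerivAt (quadTest c s B a) (innerSL ℝ (quadGrad s B a x)) x := by
  have h0 : HasFDerivAt (fun x : EuclideanSpace ℝ (Fin n) => x - a)
      (ContinuousLinearMap.id ℝ _) x := (hasFDerivAt_id x).sub_const a
  have h1 := ((hasFDerivAt_const s x).inner ℝ h0)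
  have h2 := ((B.hasFDerivAt.comp x h0).inner ℝ h0).const_mul (1 / 2)
  refine ((h1.const_add c).add h2).congr_fderiv ?_
  ext y
  simp only [quadGrad, _root_.add_apply, _root_.smul_apply,
    ContinuousLinearMap.comp_apply, fderivInnerCLM_apply, ContinuousLinearMap.prod_apply,
    ContinuousLinearMap.id_apply, innerSL_apply_apply, inner_add_left, real_inner_smul_left,
    ContinuousLinearMap.adjoint_inner_left, _root_.zero_apply, inner_zero_left,
    smul_eq_mul, Function.comp]
  rw [real_inner_comm (B y) (x - a)]
  ring

theorem gradient_quadTest : gradient (quadTest c s B a) x = quadGrad s B a x := by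
  refine HasGradientAt.gradient ?_
  rw [hasGradientAt_iff_hasFDerivAt]
  exact hasFDerivAt_quadTest c s B a x

theorem hessian_quadTest : hessian (quadTest c s B a) x = symMatrix B := by
  have e : fderiv ℝ (quadTest c s B a) = fun x => innerSL ℝ (quadGrad s B a x) := by
    funext x; exact (hasFDerivAt_quadTest c s B a x).fderiv
  have h0 : HasFDerivAt (fun x : EuclideanSpace ℝ (Fin n) => x - a)
      (ContinuousLinearMap.id ℝ _) x := (hasFDerivAt_id x).sub_const a
  have h1 : HasFDerivAt (quadGrad s B a)
      ((1 / 2 : ℝ) • ((B + ContinuousLinearMap.adjoint B).comp (ContinuousLinearMap.id ℝ _))) x :=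
    (((B + ContinuousLinearMap.adjoint B).hasFDerivAt.comp x h0).const_smul (1 / 2 : ℝ)).const_add s
  have h2 := ((innerSL ℝ (E := EuclideanSpace ℝ (Fin n))).hasFDerivAt.comp x h1).fderiv
  ext i j
  simp only [hessian, symMatrix, Matrix.of_apply]
  rw [iteratedFDeriv_two_apply, e]
  have h3 : (fun x => innerSL ℝ (quadGrad s B a x)) = (innerSL ℝ) ∘ quadGrad s B a := rfl
  rw [h3, h2]
  simp only [ContinuousLinearMap.comp_apply, _root_.smul_apply,
    _root_.add_apply, ContinuousLinearMap.id_apply, Matrix.cons_val_zero, Matrix.cons_val_one]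
  change inner ℝ ((1 / 2 : ℝ) • (B (EuclideanSpace.single i 1) +
    ContinuousLinearMap.adjoint B (EuclideanSpace.single i 1))) (EuclideanSpace.single j 1) = _
  rw [real_inner_smul_left, inner_add_left, ContinuousLinearMap.adjoint_inner_left]
  rw [real_inner_comm (B (EuclideanSpace.single j 1))]

theorem contDiff_quadTest : ContDiff ℝ ∞ (quadTest c s B a) := by
  unfold quadTest
  have h0 : ContDiff ℝ ∞ fun x : EuclideanSpace ℝ (Fin n) => x - a := contDiff_id.sub contDiff_const
  exact (contDiff_const.add (contDiff_const.inner ℝ h0)).add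
    (contDiff_const.mul ((B.contDiff.comp h0).inner ℝ h0))

theorem quadGrad_self : quadGrad s B a a = s := by simp [quadGrad]

theorem projHessian_quadTest (η : EuclideanSpace ℝ (Fin n)) :
    projHessian (quadTest c s B a) η x = gammaMat η * symMatrix B * gammaMat η := by
  rw [projHessian, hessian_quadTest]

theorem norm_inv_norm_smul {s : EuclideanSpace ℝ (Fin n)} (hs : s ≠ 0) : ‖‖s‖⁻¹ • s‖ = 1 := by
  rw [norm_smul, norm_inv, norm_norm, inv_mul_cancel₀ (norm_ne_zero_iff.2 hs)]

theorem tendsto_eigenvalueVec_gammaMat_conj {α : Type*} {l : Filter α}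
    {p : α → EuclideanSpace ℝ (Fin n)} {X : α → Matrix (Fin n) (Fin n) ℝ}
    {p₀ : EuclideanSpace ℝ (Fin n)} {X₀ : Matrix (Fin n) (Fin n) ℝ}
    (hX : ∀ k, (X k).IsHermitian) (hX₀ : X₀.IsHermitian)
    (hp : Tendsto p l (𝓝 p₀)) (hp₀ : p₀ ≠ 0) (hlim : Tendsto X l (𝓝 X₀)) :
    Tendsto (fun k => eigenvalueVec
      (gammaMat (‖p k‖⁻¹ • p k) * X k * gammaMat (‖p k‖⁻¹ • p k))) l
      (𝓝 (eigenvalueVec (gammaMat (‖p₀‖⁻¹ • p₀) * X₀ * gammaMat (‖p₀‖⁻¹ • p₀)))) := by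
  have h1 : Tendsto (fun k => ‖p k‖⁻¹ • p k) l (𝓝 (‖p₀‖⁻¹ • p₀)) :=
    (hp.norm.inv₀ (norm_ne_zero_iff.2 hp₀)).smul hp
  have h2 : Tendsto (fun k => gammaMat (‖p k‖⁻¹ • p k)) l (𝓝 (gammaMat (‖p₀‖⁻¹ • p₀))) :=
    (continuous_gammaMat.tendsto _).comp h1
  exact tendsto_eigenvalueVec (fun k => isHermitian_gammaMat_conj (hX k) _)
    (isHermitian_gammaMat_conj hX₀ _) ((h2.mul hlim).mul h2)

end QuadraticTest

/-! ### Viscosity inequalities for touching paraboloids. -/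

section Viscosity

variable {n : ℕ} {K : Set (Fin n → ℝ)} {f : (Fin n → ℝ) → ℝ} (hf : IsCurvatureFunction K f)
  {U : Set (EuclideanSpace ℝ (Fin n))} (hUo : IsOpen U) {u v : EuclideanSpace ℝ (Fin n) → ℝ}
  {a s : EuclideanSpace ℝ (Fin n)}
  {B : EuclideanSpace ℝ (Fin n) →L[ℝ] EuclideanSpace ℝ (Fin n)}

include hf hUo

/-- Nonvanishing of the gradient and membership in the open cone both persist near `a`. -/
theorem exists_isOpen_admissible_quadTest (ha : a ∈ U) (hs : s ≠ 0)
    (hK : eigenvalueVec (gammaMat (‖s‖⁻¹ • s) * symMatrix B * gammaMat (‖s‖⁻¹ • s)) ∈ K) (c : ℝ) :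
    ∃ D, IsOpen D ∧ D ⊆ U ∧ a ∈ D ∧ Admissible K f D (quadTest c s B a) := by
  have hg : Tendsto (quadGrad s B a) (𝓝 a) (𝓝 s) := by
    have hc : Continuous (quadGrad s B a) := by unfold quadGrad; fun_prop
    simpa [quadGrad_self] using hc.tendsto a
  have h1 := (tendsto_eigenvalueVec_gammaMat_conj (fun _ => isHermitian_symMatrix B)
    (isHermitian_symMatrix B) hg hs tendsto_const_nhds).eventually (hf.isOpen.mem_nhds hK)
  obtain ⟨D, hD, hDo, haD⟩ := _root_.eventually_nhds_iff.1
    (h1.and ((hg.eventually_ne hs).and (hUo.mem_nhds ha)))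
  refine ⟨D, hDo, fun x hx => (hD x hx).2.2, haD, fun x hx => ⟨fun _ => ?_, fun h0 => ?_⟩⟩
  · rw [unitGrad, gradient_quadTest, projHessian_quadTest]
    exact ⟨subset_closure (hD x hx).1, hf.pos _ (hD x hx).1⟩
  · rw [gradient_quadTest] at h0
    exact absurd h0 (hD x hx).2.1

/-- No admissibility is assumed: were the conclusion false, increasing the Hessian by `t • 1` would
keep the paraboloid above `u` and make it admissible with `F < 1`. -/
theorem IsWeakSubsolution.one_le_of_quadratic_touch (hu : IsWeakSubsolution K f U u) (ha : a ∈ U)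
    (hs : s ≠ 0)
    (htouch : ∀ᶠ x in 𝓝 a, u x ≤ u a + inner ℝ s (x - a) + 1 / 2 * inner ℝ (B (x - a)) (x - a)) :
    InDomain K (gammaMat (‖s‖⁻¹ • s) * symMatrix B * gammaMat (‖s‖⁻¹ • s)) ∧
      1 ≤ curvF f (gammaMat (‖s‖⁻¹ • s) * symMatrix B * gammaMat (‖s‖⁻¹ • s)) := by
  by_contra hnot
  obtain ⟨t, ht, htK, ht1⟩ := hf.exists_nonneg_shift_gammaMat (isHermitian_symMatrix B)
    (norm_inv_norm_smul hs) hnot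
  rw [← symMatrix_add_smul_id] at htK ht1
  set B' := B + t • ContinuousLinearMap.id ℝ (EuclideanSpace ℝ (Fin n)) with hB'
  obtain ⟨D, hDo, hDU, haD, hadm⟩ := exists_isOpen_admissible_quadTest hf hUo ha hs htK (u a)
  have hmax : IsLocalMax (fun x => u x - quadTest (u a) s B' a x) a := by
    filter_upwards [htouch] with x hx
    have e : inner ℝ (B' (x - a)) (x - a) = inner ℝ (B (x - a)) (x - a) + t * ‖x - a‖ ^ 2 := by
      simp [hB', inner_add_left, real_inner_smul_left]
    have : 0 ≤ t * ‖x - a‖ ^ 2 := by positivity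
    simp only [quadTest, e, sub_self, map_zero, inner_zero_right, mul_zero, add_zero]
    linarith
  have h1 := (hu.2 D _ hDo hDU (contDiff_quadTest _ _ _ _) hadm a haD hmax).1
  rw [unitGrad, gradient_quadTest, quadGrad_self, projHessian_quadTest] at h1
  exact absurd (h1 hs) (not_le.2 ht1)

/-- Raising a paraboloid would break contact from below, so membership in `K` has to be a hypothesis
here. -/
theorem IsWeakSupersolution.le_one_of_quadratic_touch (hv : IsWeakSupersolution K f U v)
    (ha : a ∈ U) (hs : s ≠ 0)
    (htouch : ∀ᶠ x in 𝓝 a, v a + inner ℝ s (x - a) + 1 / 2 * inner ℝ (B (x - a)) (x - a) ≤ v x)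
    (hK : eigenvalueVec (gammaMat (‖s‖⁻¹ • s) * symMatrix B * gammaMat (‖s‖⁻¹ • s)) ∈ K) :
    curvF f (gammaMat (‖s‖⁻¹ • s) * symMatrix B * gammaMat (‖s‖⁻¹ • s)) ≤ 1 := by
  obtain ⟨D, hDo, hDU, haD, hadm⟩ := exists_isOpen_admissible_quadTest hf hUo ha hs hK (v a)
  have hmin : IsLocalMin (fun x => v x - quadTest (v a) s B a x) a := by
    filter_upwards [htouch] with x hx
    simp only [quadTest, sub_self, map_zero, inner_zero_right, mul_zero, add_zero]
    linarith
  have h1 := (hv.2 D _ hDo hDU (contDiff_quadTest _ _ _ _) hadm a haD hmin).1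
  rw [unitGrad, gradient_quadTest, quadGrad_self, projHessian_quadTest] at h1
  exact h1 hs

/-- A weak subsolution cannot be touched from above by a flat paraboloid at its vertex. -/
theorem IsWeakSubsolution.not_flat_touch (hu : IsWeakSubsolution K f U u) (ha : a ∈ U)
    {c : ℝ} (hc : 0 < c) (hc1 : c < 1) (htouch : ∀ᶠ x in 𝓝 a, u x ≤ u a + 1 / 2 * (c * ‖x - a‖ ^ 2)) :
    False := by
  set B := c • ContinuousLinearMap.id ℝ (EuclideanSpace ℝ (Fin n)) with hB
  have hBm : symMatrix B = c • 1 := by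
    have := symMatrix_add_smul_id (0 : EuclideanSpace ℝ (Fin n) →L[ℝ] _) c
    rw [zero_add] at this
    rw [hB, this]
    ext i j; simp [symMatrix]
  have hone : eigenvalueVec (c • (1 : Matrix (Fin n) (Fin n) ℝ)) = fun _ => c :=
    funext fun i => eigenvalueVec_smul_one c i
  have hcherm : (c • (1 : Matrix (Fin n) (Fin n) ℝ)).IsHermitian := hBm ▸ isHermitian_symMatrix B
  -- Where the gradient is nonzero the projected Hessian is `c • gammaMat η`; where it vanishes, the
  -- choice `η = 0` leaves `c • 1`.
  have hadm : Admissible K f U (quadTest (u a) 0 B a) := by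
    refine fun x _ => ⟨fun hg => ?_, fun _ => ⟨0, by simp, ?_⟩⟩
    · rw [gradient_quadTest] at hg
      rw [unitGrad, gradient_quadTest, projHessian_quadTest, hBm]
      set η := ‖quadGrad 0 B a x‖⁻¹ • quadGrad 0 B a x
      have hη : ‖η‖ = 1 := norm_inv_norm_smul hg
      rw [Matrix.mul_smul, Matrix.mul_one, Matrix.smul_mul, gammaMat_mul_self hη]
      have hmem : eigenvalueVec (c • gammaMat η) ∈ K := by
        rw [eigenvalueVec_smul (isHermitian_gammaMat η) hc]
        exact hf.cone _ (hf.eigenvalueVec_gammaMat_mem hη) c hc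
      exact ⟨subset_closure hmem, hf.pos _ hmem⟩
    · rw [projHessian_quadTest, hBm]
      have hg0 : gammaMat (0 : EuclideanSpace ℝ (Fin n)) = 1 := by
        ext i j; simp [gammaMat, Matrix.one_apply]
      rw [hg0, one_mul, mul_one, InDomain, curvF, hone, hf.apply_const hc]
      exact ⟨subset_closure (hf.mem_of_pos fun _ => hc), hc⟩
  have hmax : IsLocalMax (fun x => u x - quadTest (u a) 0 B a x) a := by
    filter_upwards [htouch] with x hx
    have e : inner ℝ (B (x - a)) (x - a) = c * ‖x - a‖ ^ 2 := by
      simp [hB, real_inner_smul_left]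
    simp only [quadTest, e, sub_self, map_zero, inner_zero_right, mul_zero, add_zero,
      inner_zero_left]
    linarith
  obtain ⟨η, hη, hdom, h1⟩ := (hu.2 U _ hUo subset_rfl (contDiff_quadTest _ _ _ _) hadm a ha hmax).2
    (by rw [gradient_quadTest, quadGrad_self])
  rw [projHessian_quadTest, hBm] at hdom h1
  -- For every `‖η‖ ≤ 1` the map `gammaMat η` is a contraction, so no choice of `η` can reach 1.
  have h2 : curvF f (gammaMat η * c • 1 * gammaMat η) ≤ c := by
    have h3 : curvF f (gammaMat η * c • 1 * gammaMat η)
        ≤ f (eigenvalueVec (c • (1 : Matrix (Fin n) (Fin n) ℝ))) := by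
      refine hf.mono hdom (eigenvalueVec_mono (isHermitian_gammaMat_conj hcherm η) hcherm
        fun h => ?_)
      rw [dotProduct_gammaMat_conj, Matrix.smul_mulVec, Matrix.one_mulVec,
        dotProduct_smul, Matrix.smul_mulVec, Matrix.one_mulVec, dotProduct_smul]
      exact mul_le_mul_of_nonneg_left (gammaMat_mulVec_dotProduct_self_le hη h) hc.le
    rwa [hone, hf.apply_const hc] at h3
  linarith

end Viscosity

/-! ### Sup-convolutions and the quartic penalty. -/

section SupConvolution

variable {E : Type*} [NormedAddCommGroup E]

/-- `α` selects maximum points in the definition of the sup-convolution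
`sup_{b ∈ C} (p b - N ‖b - x‖²)` of `p`. -/
def IsSupConvSelection (N : ℝ) (C : Set E) (p : E → ℝ) (α : E → E) : Prop :=
  ∀ x, α x ∈ C ∧ ∀ b ∈ C, p b - N * ‖b - x‖ ^ 2 ≤ p (α x) - N * ‖α x - x‖ ^ 2

/-- The sup-convolution of `p`, in terms of a selection `α` of maximum points. -/
def supConv (N : ℝ) (p : E → ℝ) (α : E → E) : E → ℝ :=
  fun x => p (α x) - N * ‖α x - x‖ ^ 2

variable {N : ℝ} {C : Set E} {p : E → ℝ} {α : E → E}

theorem exists_isSupConvSelection (hC : IsCompact C) (hne : C.Nonempty) (hp : ContinuousOn p C)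
    (N : ℝ) : ∃ α, IsSupConvSelection N C p α := by
  have h : ∀ x : E, ∃ a ∈ C, ∀ b ∈ C, p b - N * ‖b - x‖ ^ 2 ≤ p a - N * ‖a - x‖ ^ 2 := by
    intro x
    have hc : ContinuousOn (fun b => p b - N * ‖b - x‖ ^ 2) C := by fun_prop
    obtain ⟨a, haC, ha⟩ := hC.exists_isMaxOn hne hc
    exact ⟨a, haC, fun b hb => ha hb⟩
  choose α h1 h2 using h
  exact ⟨α, fun x => ⟨h1 x, h2 x⟩⟩

theorem IsSupConvSelection.le_supConv (h : IsSupConvSelection N C p α) {x b : E} (hb : b ∈ C) :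
    p b - N * ‖b - x‖ ^ 2 ≤ supConv N p α x := (h x).2 b hb

theorem IsSupConvSelection.le_supConv_self (h : IsSupConvSelection N C p α) {x : E} (hx : x ∈ C) :
    p x ≤ supConv N p α x := by
  simpa using h.le_supConv (x := x) hx

/-- Moving `x` by the displacement from `α x` to `b` keeps the penalty fixed. This transfers upper
bounds on the sup-convolution at `x` to `p` at `α x`. -/
theorem IsSupConvSelection.le_supConv_translate (h : IsSupConvSelection N C p α) {x b : E}
    (hb : b ∈ C) : p b ≤ supConv N p α (x + (b - α x)) + N * ‖α x - x‖ ^ 2 := by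
  have h1 := h.le_supConv (x := x + (b - α x)) hb
  have e : b - (x + (b - α x)) = α x - x := by abel
  rw [e] at h1
  linarith

theorem IsSupConvSelection.supConv_le (h : IsSupConvSelection N C p α) (hN : 0 ≤ N) {M : ℝ}
    (hM : ∀ b ∈ C, p b ≤ M) (x : E) : supConv N p α x ≤ M := by
  have h1 := hM _ (h x).1
  have : 0 ≤ N * ‖α x - x‖ ^ 2 := by positivity
  rw [supConv]; linarith

/-- The extra term `‖x‖` leaves room for linear perturbations of slope at most one, so perturbed
maxima are still attained. -/
theorem IsSupConvSelection.exists_supConv_add_norm_lt (h : IsSupConvSelection N C p α)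
    (hN : 0 < N) {M r : ℝ} (hM : ∀ b ∈ C, p b ≤ M) (hr : ∀ b ∈ C, ‖b‖ ≤ r) (T : ℝ) :
    ∃ R, ∀ x, R < ‖x‖ → supConv N p α x + ‖x‖ < T := by
  refine ⟨r + ((|M + r - T| + 2) / N + 1), fun x hx => ?_⟩
  have h1 := hM _ (h x).1
  have h2 := hr _ (h x).1
  have h3 : ‖x‖ ≤ ‖α x - x‖ + ‖α x‖ := by
    calc ‖x‖ = ‖α x - (α x - x)‖ := by congr 1; abel
      _ ≤ ‖α x‖ + ‖α x - x‖ := norm_sub_le _ _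
      _ = _ := add_comm _ _
  set t := ‖α x - x‖ with ht
  set D := |M + r - T| with hD
  have hD0 : 0 ≤ D := abs_nonneg _
  have h4 : (D + 2) / N + 1 < t := by linarith
  have h40 : 0 ≤ (D + 2) / N := by positivity
  have h5 : D + 2 ≤ N * t := by
    have : N * ((D + 2) / N) ≤ N * t := by gcongr; linarith
    rwa [mul_div_cancel₀ _ hN.ne'] at this
  have h6 : (D + 2) * t ≤ N * t * t := by gcongr
  have h7 : M + r - T ≤ D := le_abs_self _
  rw [supConv]
  nlinarith

theorem exists_penalty_forces_interior [ProperSpace E] {U : Set E} (hUo : IsOpen U)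
    (hUb : Bornology.IsBounded U) {p q : E → ℝ} (hp : ContinuousOn p (closure U))
    (hq : ContinuousOn q (closure U)) (hp0 : ∀ x ∈ frontier U, p x ≤ 0)
    (hq0 : ∀ x ∈ frontier U, q x ≤ 0) {m : ℝ} (hm : 0 < m) :
    ∃ N : ℝ, 0 < N ∧ ∀ a ∈ closure U, ∀ b ∈ closure U, ∀ x y,
      m / 2 ≤ p a - N * ‖a - x‖ ^ 2 + (q b - N * ‖b - y‖ ^ 2) - N * ‖x - y‖ ^ 4 →
        a ∈ U ∧ b ∈ U := by
  have hC : IsCompact (closure U) := hUb.isCompact_closure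
  obtain ⟨M₁, hM₁⟩ := (hC.bddAbove_image hp)
  obtain ⟨M₂, hM₂⟩ := (hC.bddAbove_image hq)
  replace hM₁ : ∀ a ∈ closure U, p a ≤ M₁ := fun a ha => hM₁ (mem_image_of_mem p ha)
  replace hM₂ : ∀ a ∈ closure U, q a ≤ M₂ := fun a ha => hM₂ (mem_image_of_mem q ha)
  obtain ⟨ρ₁, hρ₁, h₁⟩ := Metric.uniformContinuousOn_iff.1
    (hC.uniformContinuousOn_of_continuous hp) (m / 4) (by positivity)
  obtain ⟨ρ₂, hρ₂, h₂⟩ := Metric.uniformContinuousOn_iff.1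
    (hC.uniformContinuousOn_of_continuous hq) (m / 4) (by positivity)
  set ρ := min ρ₁ ρ₂ / 3 with hρ
  have hρ0 : 0 < ρ := by positivity
  set B := |M₁| + |M₂| with hB
  have hB0 : 0 ≤ B := by positivity
  -- The two terms make any of the three penalties exceed `B` once its distance reaches `ρ`. Hence
  -- `a` and `b` are within `3 * ρ`, and if either were on the boundary, uniform continuity would
  -- force `p a + q b < m / 2`.
  set N := (B + 1) / ρ ^ 2 + (B + 1) / ρ ^ 4 with hN
  have hN0 : 0 < N := by positivity
  have hN2 : B + 1 ≤ N * ρ ^ 2 := by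
    have : (B + 1) / ρ ^ 2 * ρ ^ 2 ≤ N * ρ ^ 2 := by
      gcongr; rw [hN]; linarith [show 0 < (B + 1) / ρ ^ 4 by positivity]
    rwa [div_mul_cancel₀ _ (by positivity)] at this
  have hN4 : B + 1 ≤ N * ρ ^ 4 := by
    have : (B + 1) / ρ ^ 4 * ρ ^ 4 ≤ N * ρ ^ 4 := by
      gcongr; rw [hN]; linarith [show 0 < (B + 1) / ρ ^ 2 by positivity]
    rwa [div_mul_cancel₀ _ (by positivity)] at this
  refine ⟨N, hN0, fun a ha b hb x y h => ?_⟩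
  have hpa := (hM₁ a ha).trans (le_abs_self M₁)
  have hqb := (hM₂ b hb).trans (le_abs_self M₂)
  have n1 : 0 ≤ N * ‖a - x‖ ^ 2 := by positivity
  have n2 : 0 ≤ N * ‖b - y‖ ^ 2 := by positivity
  have n3 : 0 ≤ N * ‖x - y‖ ^ 4 := by positivity
  have d1 : ‖a - x‖ < ρ := by
    by_contra hc
    push Not at hc
    have : N * ρ ^ 2 ≤ N * ‖a - x‖ ^ 2 := by gcongr
    linarith
  have d2 : ‖b - y‖ < ρ := by
    by_contra hc
    push Not at hc
    have : N * ρ ^ 2 ≤ N * ‖b - y‖ ^ 2 := by gcongr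
    linarith
  have d3 : ‖x - y‖ < ρ := by
    by_contra hc
    push Not at hc
    have : N * ρ ^ 4 ≤ N * ‖x - y‖ ^ 4 := by gcongr
    linarith
  have hab : dist a b < 3 * ρ := by
    calc dist a b = ‖(a - x) + (x - y) - (b - y)‖ := by rw [dist_eq_norm]; congr 1; abel
      _ ≤ ‖a - x‖ + ‖x - y‖ + ‖b - y‖ :=
        (norm_sub_le _ _).trans (by gcongr; exact norm_add_le _ _)
      _ < 3 * ρ := by linarith
  have h3ρ : 3 * ρ = min ρ₁ ρ₂ := by rw [hρ]; ring
  rw [h3ρ] at hab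
  have c1 := abs_lt.1 (h₁ a ha b hb (hab.trans_le (min_le_left _ _)))
  have c2 := abs_lt.1 (h₂ a ha b hb (hab.trans_le (min_le_right _ _)))
  constructor
  · by_contra hc
    have hfr : a ∈ frontier U := ⟨ha, by rwa [hUo.interior_eq]⟩
    linarith [hp0 a hfr, hq0 a hfr]
  · by_contra hc
    have hfr : b ∈ frontier U := ⟨hb, by rwa [hUo.interior_eq]⟩
    linarith [hp0 b hfr, hq0 b hfr]

variable [InnerProductSpace ℝ E]

/-- Freezing the maximum point `α x` gives a paraboloid below the sup-convolution that touches it at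
`x`. -/
theorem IsSupConvSelection.semiconvexSelection (h : IsSupConvSelection N C p α) :
    SemiconvexSelection N (supConv N p α) fun x => (2 * N) • (α x - x) := by
  intro x y
  have h1 := h.le_supConv (x := y) (h x).1
  have e : ‖α x - y‖ ^ 2 = ‖α x - x‖ ^ 2 - 2 * inner ℝ (α x - x) (y - x) + ‖y - x‖ ^ 2 := by
    rw [← norm_sub_sq_real]; congr 2; abel
  rw [e] at h1
  rw [real_inner_smul_left]
  simp only [supConv] at h1 ⊢
  linarith

theorem IsSupConvSelection.continuous_supConv (h : IsSupConvSelection N C p α) (hN : 0 ≤ N)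
    {r : ℝ} (hr : ∀ b ∈ C, ‖b‖ ≤ r) : Continuous (supConv N p α) := by
  have hlow : ∀ x y, supConv N p α x - supConv N p α y
      ≤ 2 * N * (r + ‖x‖) * ‖y - x‖ + N * ‖y - x‖ ^ 2 := by
    intro x y
    have h1 := h.semiconvexSelection x y
    rw [real_inner_smul_left] at h1
    have h2 := (abs_le.1 (abs_real_inner_le_norm (α x - x) (y - x))).1
    have h3 : ‖α x - x‖ ≤ r + ‖x‖ := (norm_sub_le _ _).trans (by gcongr; exact hr _ (h x).1)
    have h4 : ‖α x - x‖ * ‖y - x‖ ≤ (r + ‖x‖) * ‖y - x‖ := by gcongr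
    have h5 : 2 * N * (-((r + ‖x‖) * ‖y - x‖)) ≤ 2 * N * inner ℝ (α x - x) (y - x) := by
      gcongr; linarith
    linarith
  rw [continuous_iff_continuousAt]
  intro x
  rw [ContinuousAt, tendsto_iff_norm_sub_tendsto_zero]
  have hlim : Tendsto (fun y => 2 * N * (r + ‖x‖ + ‖y‖) * ‖y - x‖ + N * ‖y - x‖ ^ 2) (𝓝 x)
      (𝓝 0) := by
    have hc : Continuous fun y => 2 * N * (r + ‖x‖ + ‖y‖) * ‖y - x‖ + N * ‖y - x‖ ^ 2 := by
      fun_prop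
    simpa using hc.tendsto x
  refine squeeze_zero (fun _ => norm_nonneg _) (fun y => ?_) hlim
  have h1 := hlow x y
  have h2 := hlow y x
  rw [norm_sub_rev x y] at h2
  have e1 : 2 * N * (r + ‖x‖) * ‖y - x‖ ≤ 2 * N * (r + ‖x‖ + ‖y‖) * ‖y - x‖ := by
    have := le_add_of_nonneg_right (a := r + ‖x‖) (norm_nonneg y)
    exact mul_le_mul_of_nonneg_right (mul_le_mul_of_nonneg_left this (by positivity))
      (norm_nonneg _)
  have e2 : 2 * N * (r + ‖y‖) * ‖y - x‖ ≤ 2 * N * (r + ‖x‖ + ‖y‖) * ‖y - x‖ := by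
    have : r + ‖y‖ ≤ r + ‖x‖ + ‖y‖ := by linarith [norm_nonneg x]
    exact mul_le_mul_of_nonneg_right (mul_le_mul_of_nonneg_left this (by positivity))
      (norm_nonneg _)
  rw [Real.norm_eq_abs, abs_le]
  constructor <;> linarith

/-- A second order expansion of the sup-convolution at `x` yields a quadratic upper bound of the
original function at `α x`. -/
theorem IsSupConvSelection.eventually_le_quadratic (h : IsSupConvSelection N C p α) {x s : E}
    {A : E →L[ℝ] E} {ε : ℝ}
    (hT : ∀ᶠ k in 𝓝 (0 : E), |supConv N p α (x + k) - supConv N p α x - inner ℝ s k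
      - 1 / 2 * inner ℝ (A k) k| ≤ ε * ‖k‖ ^ 2) :
    ∀ᶠ b in 𝓝 (α x), b ∈ C → p b ≤ p (α x) + inner ℝ s (b - α x) +
      1 / 2 * inner ℝ (A (b - α x)) (b - α x) + ε * ‖b - α x‖ ^ 2 := by
  have hlim : Tendsto (fun b => b - α x) (𝓝 (α x)) (𝓝 0) := by
    have hc : Continuous fun b => b - α x := by fun_prop
    simpa using hc.tendsto (α x)
  filter_upwards [hlim.eventually hT] with b hb hbC
  have h1 := h.le_supConv_translate (x := x) hbC
  have h2 := (abs_le.1 hb).2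
  have e : supConv N p α x = p (α x) - N * ‖α x - x‖ ^ 2 := rfl
  linarith

theorem SemiconvexSelection.translate {K : ℝ} {g : E → ℝ} {s : E → E}
    (hs : SemiconvexSelection K g s) (k : E) :
    SemiconvexSelection K (fun x => g (x + k)) fun x => s (x + k) := by
  intro x y
  have := hs (x + k) (y + k)
  rwa [add_sub_add_right_eq_sub] at this

/-- A vector `s` that is a subgradient, up to a quadratic error, of the quartic penalty at `k ≠ 0`
does not vanish. -/
theorem ne_zero_of_inner_le_quartic {N : ℝ} (hN : 0 < N) {k s : E} (hk : k ≠ 0)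
    (h : ∀ y, inner ℝ s y ≤ N * ‖y‖ ^ 2 + N * (‖k + y‖ ^ 4 - ‖k‖ ^ 4)) : s ≠ 0 := by
  rintro rfl
  have hk0 : 0 < ‖k‖ := norm_pos_iff.2 hk
  set t := min (1 / 2) (‖k‖ ^ 2 / 2) with ht
  have ht0 : 0 < t := lt_min (by norm_num) (by positivity)
  have ht1 : t ≤ 1 / 2 := min_le_left _ _
  have ht2 : t ≤ ‖k‖ ^ 2 / 2 := min_le_right _ _
  -- Moving towards the origin lowers the quartic to first order in `t`, while the quadratic error
  -- is of order `t²`; with `s = 0` this would force `t ≥ ‖k‖ ^ 2`.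
  have h1 := h (-(t • k))
  have e : k + -(t • k) = (1 - t) • k := by rw [sub_smul, one_smul, sub_eq_add_neg]
  rw [e, inner_zero_left, norm_neg, norm_smul, norm_smul, Real.norm_eq_abs, Real.norm_eq_abs,
    abs_of_pos ht0, abs_of_pos (by linarith : 0 < 1 - t), mul_pow, mul_pow, ← mul_add] at h1
  have h2 : 0 ≤ t ^ 2 * ‖k‖ ^ 2 + ((1 - t) ^ 4 * ‖k‖ ^ 4 - ‖k‖ ^ 4) :=
    nonneg_of_mul_nonneg_right h1 hN
  have h3 : (1 - t) ^ 4 ≤ 1 - t := by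
    calc (1 - t) ^ 4 ≤ (1 - t) ^ 1 := pow_le_pow_of_le_one (by linarith) (by linarith) (by norm_num)
      _ = 1 - t := pow_one _
  have h4 : (1 - t) ^ 4 * ‖k‖ ^ 4 ≤ (1 - t) * ‖k‖ ^ 4 := by gcongr
  have h5 : 0 ≤ (t * ‖k‖ ^ 2) * (t - ‖k‖ ^ 2) := by nlinarith
  have h6 : 0 ≤ t - ‖k‖ ^ 2 := nonneg_of_mul_nonneg_right h5 (by positivity)
  nlinarith

end SupConvolution

/-! ### The comparison argument. -/

section Comparison

variable {n : ℕ} {K : Set (Fin n → ℝ)} {f : (Fin n → ℝ) → ℝ} (hf : IsCurvatureFunction K f)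
  {U : Set (EuclideanSpace ℝ (Fin n))} (hUo : IsOpen U) {u v : EuclideanSpace ℝ (Fin n) → ℝ}

include hf

/-- Matrices `A ≤ Y` cannot arise as limits of Hessians of a strict subsolution and of a
supersolution with the same gradient. -/
theorem false_of_tendsto_hessians {l : Filter ℕ} [l.NeBot] {lam : ℝ} (hlam : 1 < lam)
    {s : EuclideanSpace ℝ (Fin n)} (hs : s ≠ 0)
    {A₁ A₂ : EuclideanSpace ℝ (Fin n) →L[ℝ] EuclideanSpace ℝ (Fin n)}
    (hA : ∀ h, inner ℝ (A₁ h) h + inner ℝ (A₂ h) h ≤ 0)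
    {p q : ℕ → EuclideanSpace ℝ (Fin n)}
    {X Y : ℕ → EuclideanSpace ℝ (Fin n) →L[ℝ] EuclideanSpace ℝ (Fin n)}
    (hp : Tendsto p l (𝓝 (lam⁻¹ • s))) (hq : Tendsto q l (𝓝 s))
    (hX : Tendsto X l (𝓝 (lam⁻¹ • A₁))) (hY : Tendsto Y l (𝓝 (-A₂)))
    (hsub : ∀ᶠ k in l,
      InDomain K (gammaMat (‖p k‖⁻¹ • p k) * symMatrix (X k) * gammaMat (‖p k‖⁻¹ • p k)) ∧
      1 ≤ curvF f (gammaMat (‖p k‖⁻¹ • p k) * symMatrix (X k) * gammaMat (‖p k‖⁻¹ • p k)))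
    (hsup : ∀ᶠ k in l,
      eigenvalueVec (gammaMat (‖q k‖⁻¹ • q k) * symMatrix (Y k) * gammaMat (‖q k‖⁻¹ • q k)) ∈ K →
      curvF f (gammaMat (‖q k‖⁻¹ • q k) * symMatrix (Y k) * gammaMat (‖q k‖⁻¹ • q k)) ≤ 1) :
    False := by
  have hlam0 : 0 < lam := by linarith
  have hls : lam⁻¹ • s ≠ 0 := smul_ne_zero (inv_ne_zero hlam0.ne') hs
  have tX := tendsto_eigenvalueVec_gammaMat_conj (fun k => isHermitian_symMatrix (X k))
    (isHermitian_symMatrix _) hp hls ((continuous_symMatrix.tendsto _).comp hX)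
  have tY := tendsto_eigenvalueVec_gammaMat_conj (fun k => isHermitian_symMatrix (Y k))
    (isHermitian_symMatrix _) hq hs ((continuous_symMatrix.tendsto _).comp hY)
  have hunit : ‖lam⁻¹ • s‖⁻¹ • lam⁻¹ • s = ‖s‖⁻¹ • s := by
    rw [norm_smul, Real.norm_eq_abs, abs_of_pos (by positivity), smul_smul, mul_inv, inv_inv]
    congr 1
    field_simp
  rw [hunit, symMatrix_smul, Matrix.mul_smul, Matrix.smul_mul,
    eigenvalueVec_smul (isHermitian_gammaMat_conj (isHermitian_symMatrix _) _)
      (by positivity)] at tX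
  set η := ‖s‖⁻¹ • s with hη
  set κ := eigenvalueVec (gammaMat η * symMatrix A₁ * gammaMat η) with hκ
  set κ' := eigenvalueVec (gammaMat η * symMatrix (-A₂) * gammaMat η) with hκ'
  have hcl : lam⁻¹ • κ ∈ closure K :=
    isClosed_closure.mem_of_tendsto tX (hsub.mono fun k hk => hk.1)
  have h1 : 1 ≤ f (lam⁻¹ • κ) := by
    refine ge_of_tendsto ((hf.continuousOn _ hcl).tendsto.comp (tendsto_nhdsWithin_iff.2
      ⟨tX, hsub.mono fun k hk => hk.1⟩)) (hsub.mono fun k hk => hk.2)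
  -- A limit of spectra is only in the closure of `K`; positivity of `f` excludes the boundary and
  -- makes homogeneity available.
  have hmem := hf.mem_of_apply_pos hcl (by linarith)
  have h2 := hf.homogeneous _ hmem lam hlam0
  have hκK := hf.cone _ hmem lam hlam0
  rw [smul_inv_smul₀ hlam0.ne'] at h2 hκK
  have hle : ∀ i, κ i ≤ κ' i := eigenvalueVec_mono
    (isHermitian_gammaMat_conj (isHermitian_symMatrix _) _)
    (isHermitian_gammaMat_conj (isHermitian_symMatrix _) _) fun h => by
      rw [dotProduct_gammaMat_conj, dotProduct_gammaMat_conj]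
      have e1 := dotProduct_symMatrix_mulVec A₁ (WithLp.toLp 2 ((gammaMat η).mulVec h))
      have e2 := dotProduct_symMatrix_mulVec (-A₂) (WithLp.toLp 2 ((gammaMat η).mulVec h))
      have e3 := hA (WithLp.toLp 2 ((gammaMat η).mulVec h))
      simp only [_root_.neg_apply, inner_neg_left] at e1 e2
      rw [e1, e2]
      linarith
  have hκ'K : κ' ∈ K := hf.mem_of_le hκK hle
  have h3 : f κ ≤ f κ' := hf.mono (subset_closure hκK) hle
  have h4 : f κ' ≤ 1 := by
    have hmemY := tY.eventually (hf.isOpen.mem_nhds hκ'K)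
    refine le_of_tendsto ((hf.continuousOn _ (subset_closure hκ'K)).tendsto.comp
      (tendsto_nhdsWithin_iff.2 ⟨tY, hmemY.mono fun k hk => subset_closure hk⟩)) ?_
    filter_upwards [hsup, hmemY] with k hk hk' using hk hk'
  nlinarith

include hUo

theorem comparison_of_strict (hUb : Bornology.IsBounded U)
    (hu : IsWeakSubsolution K f U u) (hu0 : ∀ x ∈ frontier U, u x ≤ 0)
    (hv : IsWeakSupersolution K f U v) (hv0 : ∀ x ∈ frontier U, 0 ≤ v x)
    {lam : ℝ} (hlam : 1 < lam) {x₀ : EuclideanSpace ℝ (Fin n)} (hx₀ : x₀ ∈ U) :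
    lam * u x₀ - v x₀ ≤ 0 := by
  by_contra hm
  push Not at hm
  have hlam0 : 0 < lam := by linarith
  set m := lam * u x₀ - v x₀ with hmdef
  set C := closure U with hCdef
  have hUC : U ⊆ C := subset_closure
  have hC : IsCompact C := hUb.isCompact_closure
  have hCne : C.Nonempty := ⟨x₀, hUC hx₀⟩
  set p : EuclideanSpace ℝ (Fin n) → ℝ := fun x => lam * u x with hp
  set q : EuclideanSpace ℝ (Fin n) → ℝ := fun x => -v x with hq
  have hpc : ContinuousOn p C := continuousOn_const.mul hu.1
  have hqc : ContinuousOn q C := hv.1.neg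
  obtain ⟨N, hN, hint⟩ := exists_penalty_forces_interior hUo hUb hpc hqc
    (fun x hx => by have := hu0 x hx; simp only [hp]; nlinarith)
    (fun x hx => by have := hv0 x hx; simp only [hq]; linarith) hm
  obtain ⟨α, hα⟩ := exists_isSupConvSelection hC hCne hpc N
  obtain ⟨β, hβ⟩ := exists_isSupConvSelection hC hCne hqc N
  obtain ⟨r, hr⟩ := hC.isBounded.exists_norm_le
  obtain ⟨M₁, hM₁⟩ := hC.bddAbove_image hpc
  obtain ⟨M₂, hM₂⟩ := hC.bddAbove_image hqc
  replace hM₁ : ∀ a ∈ C, p a ≤ M₁ := fun a ha => hM₁ (mem_image_of_mem p ha)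
  replace hM₂ : ∀ a ∈ C, q a ≤ M₂ := fun a ha => hM₂ (mem_image_of_mem q ha)
  set P := supConv N p α with hP
  set Q := supConv N q β with hQ
  have hPc : Continuous P := hα.continuous_supConv hN.le hr
  have hQc : Continuous Q := hβ.continuous_supConv hN.le hr
  have hPle : ∀ x, P x ≤ M₁ := hα.supConv_le hN.le hM₁
  have hQle : ∀ x, Q x ≤ M₂ := hβ.supConv_le hN.le hM₂
  have hsP : SemiconvexSelection N P fun x => (2 * N) • (α x - x) := hα.semiconvexSelection
  have hsQ : SemiconvexSelection N Q fun x => (2 * N) • (β x - x) := hβ.semiconvexSelection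
  -- the maximum of the doubled function
  set W : EuclideanSpace ℝ (Fin n) × EuclideanSpace ℝ (Fin n) → ℝ :=
    fun z => P z.1 + Q z.2 - N * ‖z.1 - z.2‖ ^ 4 with hW
  have hWc : Continuous W := by fun_prop
  have hWx₀ : m ≤ W (x₀, x₀) := by
    have h1 := hα.le_supConv_self (hUC hx₀)
    have h2 := hβ.le_supConv_self (hUC hx₀)
    simp only [hW, sub_self, norm_zero, hP, hQ, hmdef]
    simp only [hp, hq] at h1 h2 ⊢
    linarith
  obtain ⟨⟨x', y'⟩, hmax⟩ : ∃ z, ∀ z', W z' ≤ W z := by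
    obtain ⟨R₁, hR₁⟩ := hα.exists_supConv_add_norm_lt hN hM₁ hr (m - M₂)
    obtain ⟨R₂, hR₂⟩ := hβ.exists_supConv_add_norm_lt hN hM₂ hr (m - M₁)
    refine hWc.exists_forall_ge_of_isBounded (x₀, x₀)
      ((isBounded_closedBall (x := (0 : EuclideanSpace ℝ (Fin n) × EuclideanSpace ℝ (Fin n)))
        (r := max R₁ R₂)).subset ?_)
    rintro ⟨x, y⟩ hxy
    replace hxy : m ≤ P x + Q y - N * ‖x - y‖ ^ 4 := hWx₀.trans hxy
    have h0 : 0 ≤ N * ‖x - y‖ ^ 4 := by positivity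
    rw [mem_closedBall_zero_iff, Prod.norm_def]
    refine max_le_max ?_ ?_
    · by_contra hc
      have h1 := hR₁ x (not_le.1 hc)
      linarith [hQle y, norm_nonneg x]
    · by_contra hc
      have h1 := hR₂ y (not_le.1 hc)
      linarith [hPle x, norm_nonneg y]
  have hWmax : m ≤ W (x', y') := hWx₀.trans (hmax _)
  have hinterior : ∀ x y, m / 2 ≤ W (x, y) → α x ∈ U ∧ β y ∈ U := fun x y hxy =>
    hint _ (hα x).1 _ (hβ y).1 x y hxy
  rcases eq_or_ne x' y' with hxy | hk
  · -- the gradient vanishes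
    subst hxy
    have haU : α x' ∈ U := (hinterior x' x' (by linarith)).1
    -- With `x'` fixed in the second slot, the maximum of `W` bounds `lam * u` near `α x'` by a
    -- quartic, which lies below any flat paraboloid close to its vertex.
    refine hu.not_flat_touch hf hUo haU (c := 1 / 2) (by norm_num) (by norm_num) ?_
    have hsmall : ∀ᶠ b in 𝓝 (α x'), N * ‖b - α x'‖ ^ 2 < 1 / 4 := by
      have hc : Continuous fun b => N * ‖b - α x'‖ ^ 2 := by fun_prop
      have := hc.tendsto (α x')
      simp only [sub_self, norm_zero] at this
      exact this.eventually (gt_mem_nhds (by norm_num))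
    filter_upwards [hsmall, hUo.mem_nhds haU] with b hb hbU
    have h1 := hα.le_supConv_translate (x := x') (hUC hbU)
    have h2 := hmax (x' + (b - α x'), x')
    simp only [hW, add_sub_cancel_left, sub_self, norm_zero] at h2
    have h3 : P x' = p (α x') - N * ‖α x' - x'‖ ^ 2 := rfl
    have h4 : p b ≤ p (α x') + N * ‖b - α x'‖ ^ 4 := by
      rw [← hP] at h1
      linarith
    simp only [hp] at h4
    have h5 : N * ‖b - α x'‖ ^ 4 ≤ 1 / 4 * ‖b - α x'‖ ^ 2 := by nlinarith [sq_nonneg ‖b - α x'‖]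
    have h6 : 1 / 4 * ‖b - α x'‖ ^ 2 ≤ lam * (1 / 4 * ‖b - α x'‖ ^ 2) := by
      nlinarith [sq_nonneg ‖b - α x'‖]
    have h7 : lam * u b ≤ lam * (u (α x') + 1 / 2 * (1 / 2 * ‖b - α x'‖ ^ 2)) := by linarith
    exact le_of_mul_le_mul_left h7 hlam0
  -- the gradient does not vanish
  set k₀ := x' - y' with hk₀
  have hk₀ne : k₀ ≠ 0 := sub_ne_zero.2 hk
  -- Shifting by the fixed `k₀` reduces the doubled problem to a sum of two semiconvex functions of
  -- a single variable.
  set g₁ : EuclideanSpace ℝ (Fin n) → ℝ := fun x => P (x + k₀) with hg₁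
  set s₁ : EuclideanSpace ℝ (Fin n) → EuclideanSpace ℝ (Fin n) :=
    fun x => (2 * N) • (α (x + k₀) - (x + k₀)) with hs₁
  set s₂ : EuclideanSpace ℝ (Fin n) → EuclideanSpace ℝ (Fin n) :=
    fun x => (2 * N) • (β x - x) with hs₂
  have h₁ : SemiconvexSelection N g₁ s₁ := hsP.translate k₀
  have hg₁c : Continuous g₁ := by fun_prop
  have hwc : Continuous fun x => g₁ x + Q x := by fun_prop
  obtain ⟨R, hR⟩ := hβ.exists_supConv_add_norm_lt hN hM₂ hr (g₁ 0 + Q 0 - M₁)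
  have hbound : ∀ z s : EuclideanSpace ℝ (Fin n), ‖s‖ ≤ 1 → g₁ 0 + Q 0 ≤ g₁ z + Q z + ‖z‖ * ‖s‖ → ‖z‖ ≤ R := by
    intro z s hs hz
    by_contra hc
    have h1 := hR z (not_le.1 hc)
    have h2 := hPle (z + k₀)
    have h3 : ‖z‖ * ‖s‖ ≤ ‖z‖ := mul_le_of_le_one_right (norm_nonneg _) hs
    simp only [hg₁] at *
    linarith
  have hpert : ∀ s : EuclideanSpace ℝ (Fin n), ‖s‖ ≤ 1 → ∃ z, ∀ y,
      g₁ y + Q y ≤ g₁ z + Q z + inner ℝ s (y - z) := by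
    intro s hs
    have hc : Continuous fun x => g₁ x + Q x - inner ℝ s x := by fun_prop
    obtain ⟨z, hz⟩ := hc.exists_forall_ge_of_isBounded 0
      ((isBounded_closedBall (x := (0 : EuclideanSpace ℝ (Fin n))) (r := R)).subset fun z hz => by
        replace hz : g₁ 0 + Q 0 - inner ℝ s 0 ≤ g₁ z + Q z - inner ℝ s z := hz
        rw [inner_zero_right] at hz
        rw [mem_closedBall_zero_iff]
        refine hbound z s hs ?_
        have := (abs_le.1 (abs_real_inner_le_norm s z)).1
        linarith [mul_comm ‖s‖ ‖z‖])
    refine ⟨z, fun y => ?_⟩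
    have := hz y
    rw [inner_sub_right]
    linarith
  have hseq : ∀ k : ℕ, ∃ (z : EuclideanSpace ℝ (Fin n))
      (A₁ A₂ : EuclideanSpace ℝ (Fin n) →L[ℝ] EuclideanSpace ℝ (Fin n)),
      ‖s₁ z + s₂ z‖ ≤ 1 / ((k : ℝ) + 1) ∧
      (∀ y, g₁ y + Q y ≤ g₁ z + Q z + inner ℝ (s₁ z + s₂ z) (y - z)) ∧
      HasFDerivAt s₁ A₁ z ∧ HasFDerivAt s₂ A₂ z ∧ ‖A₁‖ ≤ 6 * N ∧ ‖A₂‖ ≤ 6 * N ∧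
      ∀ h, inner ℝ (A₁ h) h + inner ℝ (A₂ h) h ≤ 0 := by
    intro k
    have hk1 : 1 / ((k : ℝ) + 1) ≤ 1 := by
      rw [div_le_one (by positivity)]; linarith [Nat.cast_nonneg (α := ℝ) k]
    exact exists_max_hasFDerivAt_selection hN.le h₁ hsQ hwc (by positivity)
      fun s hs => hpert s (hs.trans hk1)
  choose z A₁ A₂ hδ hzmax hd₁ hd₂ hA₁ hA₂ hAA using hseq
  have hδ1 : ∀ k, ‖s₁ (z k) + s₂ (z k)‖ ≤ 1 := fun k => (hδ k).trans (by
    rw [div_le_one (by positivity)]; linarith [Nat.cast_nonneg (α := ℝ) k])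
  have hzR : ∀ k, ‖z k‖ ≤ R := fun k => by
    refine hbound (z k) _ (hδ1 k) ?_
    have h1 := hzmax k 0
    rw [zero_sub, inner_neg_right] at h1
    have := (abs_le.1 (abs_real_inner_le_norm (s₁ (z k) + s₂ (z k)) (z k))).1
    linarith [mul_comm ‖s₁ (z k) + s₂ (z k)‖ ‖z k‖]
  have hsR : ∀ k, ‖s₁ (z k)‖ ≤ 2 * N * (r + (R + ‖k₀‖)) := fun k => by
    simp only [hs₁]
    rw [norm_smul, Real.norm_eq_abs, abs_of_pos (by positivity)]
    gcongr
    refine (norm_sub_le _ _).trans (add_le_add (hr _ (hα _).1) ((norm_add_le _ _).trans ?_))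
    gcongr
    exact hzR k
  -- Coercivity bounds the points and their gradients, and the Jensen-type lemma bounds the second
  -- derivatives, so all converge along one subsequence.
  obtain ⟨⟨z', s', B₁, B₂⟩, -, φ, hφ, hlim⟩ := tendsto_subseq_of_bounded
    (isBounded_closedBall (x := (0 : EuclideanSpace ℝ (Fin n) × EuclideanSpace ℝ (Fin n) ×
      (EuclideanSpace ℝ (Fin n) →L[ℝ] EuclideanSpace ℝ (Fin n)) ×
      (EuclideanSpace ℝ (Fin n) →L[ℝ] EuclideanSpace ℝ (Fin n))))
      (r := max R (max (2 * N * (r + (R + ‖k₀‖))) (6 * N))))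
    (x := fun k => (z k, s₁ (z k), A₁ k, A₂ k)) (fun k => by
      rw [mem_closedBall_zero_iff, Prod.norm_def, Prod.norm_def, Prod.norm_def]
      exact max_le_max (hzR k) (max_le_max (hsR k) (max_le (hA₁ k) (hA₂ k))))
  have lz : Tendsto (fun k => z (φ k)) atTop (𝓝 z') := (continuous_fst.tendsto _).comp hlim
  have lrest := (continuous_snd.tendsto _).comp hlim
  have ls : Tendsto (fun k => s₁ (z (φ k))) atTop (𝓝 s') := (continuous_fst.tendsto _).comp lrest
  have lrest' := (continuous_snd.tendsto _).comp lrest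
  have lA₁ : Tendsto (fun k => A₁ (φ k)) atTop (𝓝 B₁) := (continuous_fst.tendsto _).comp lrest'
  have lA₂ : Tendsto (fun k => A₂ (φ k)) atTop (𝓝 B₂) := (continuous_snd.tendsto _).comp lrest'
  have lε : Tendsto (fun k => 1 / ((φ k : ℝ) + 1)) atTop (𝓝 0) :=
    tendsto_one_div_add_atTop_nhds_zero_nat.comp hφ.tendsto_atTop
  have lp : Tendsto (fun k => s₁ (z (φ k)) + s₂ (z (φ k))) atTop (𝓝 0) :=
    squeeze_zero_norm (fun k => hδ (φ k)) lε
  have lw : Tendsto (fun k => g₁ (z (φ k)) + Q (z (φ k))) atTop (𝓝 (g₁ z' + Q z')) :=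
    (hwc.tendsto z').comp lz
  have hz'max : ∀ y, g₁ y + Q y ≤ g₁ z' + Q z' := by
    intro y
    have t1 := lw.add (lp.inner ((tendsto_const_nhds (x := y)).sub lz))
    rw [inner_zero_left, add_zero] at t1
    exact ge_of_tendsto' t1 fun k => hzmax (φ k) y
  have hWk : ∀ x, W (x + k₀, x) = g₁ x + Q x - N * ‖k₀‖ ^ 4 := fun x => by
    simp only [hW, hg₁, add_sub_cancel_left]
  have hWz' : W (x', y') ≤ W (z' + k₀, z') := by
    have e : (x', y') = (y' + k₀, y') := by rw [hk₀, add_sub_cancel]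
    rw [e, hWk, hWk]
    linarith [hz'max y']
  have hev : ∀ᶠ k in atTop, m / 2 ≤ W (z (φ k) + k₀, z (φ k)) := by
    have t1 := lw.sub_const (N * ‖k₀‖ ^ 4)
    simp only [← hWk] at t1
    exact (t1.eventually (lt_mem_nhds (show m / 2 < W (z' + k₀, z') by linarith))).mono
      fun k hk => hk.le
  -- The limit pair `(z' + k₀, z')` again maximizes `W`. Varying only its first entry compares the
  -- slope `s'` of `P` with the quartic at `k₀`.
  have hs'ne : s' ≠ 0 := by
    refine ne_zero_of_inner_le_quartic hN hk₀ne fun y => ?_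
    have t1 : g₁ z' + inner ℝ s' (z' + y - z') - N * ‖z' + y - z'‖ ^ 2 ≤ g₁ (z' + y) := by
      have tg := (hg₁c.tendsto z').comp lz
      have ty := (tendsto_const_nhds (x := z' + y)).sub lz
      exact le_of_tendsto' ((tg.add (ls.inner ty)).sub ((ty.norm.pow 2).const_mul N))
        fun k => h₁ (z (φ k)) (z' + y)
    have t2 := (hmax (z' + y + k₀, z')).trans hWz'
    rw [hWk] at t2
    have e : z' + y + k₀ - z' = k₀ + y := by abel
    simp only [hW, e] at t2
    rw [add_sub_cancel_left] at t1
    simp only [hg₁] at t1 t2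
    linarith
  have hBB : ∀ h, inner ℝ (B₁ h) h + inner ℝ (B₂ h) h ≤ 0 := by
    intro h
    have c1 : Continuous fun A : EuclideanSpace ℝ (Fin n) →L[ℝ] EuclideanSpace ℝ (Fin n) =>
      inner ℝ (A h) h := by fun_prop
    exact le_of_tendsto' (((c1.tendsto _).comp lA₁).add ((c1.tendsto _).comp lA₂))
      fun k => hAA (φ k) h
  set id' := ContinuousLinearMap.id ℝ (EuclideanSpace ℝ (Fin n)) with hid
  have lε2 : Tendsto (fun k => (2 * (1 / ((φ k : ℝ) + 1))) • id') atTop (𝓝 0) := by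
    have hc : Continuous fun t : ℝ => (2 * t) • id' := by fun_prop
    have e : (2 * (0 : ℝ)) • id' = 0 := by rw [mul_zero]; exact zero_smul ℝ id'
    have := (hc.tendsto 0).comp lε
    rwa [e] at this
  have lq : Tendsto (fun k => -s₂ (z (φ k))) atTop (𝓝 s') := by
    have := ls.sub lp
    rw [sub_zero] at this
    refine this.congr fun k => ?_
    abel
  have lpl : Tendsto (fun k => lam⁻¹ • s₁ (z (φ k))) atTop (𝓝 (lam⁻¹ • s')) := ls.const_smul _
  -- The Taylor error `ε * ‖d‖ ^ 2` is absorbed into the Hessian as `2 * ε` times the identity,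
  -- because of the factor `1 / 2` in the quadratic form.
  have lX : Tendsto (fun k => lam⁻¹ • (A₁ (φ k) + (2 * (1 / ((φ k : ℝ) + 1))) • id')) atTop
      (𝓝 (lam⁻¹ • B₁)) := by
    have := (lA₁.add lε2).const_smul lam⁻¹
    rwa [add_zero] at this
  have lY : Tendsto (fun k => -(A₂ (φ k) + (2 * (1 / ((φ k : ℝ) + 1))) • id')) atTop
      (𝓝 (-B₂)) := by
    have := (lA₂.add lε2).neg
    rwa [add_zero] at this
  refine false_of_tendsto_hessians hf hlam hs'ne hBB lpl lq lX lY ?_ ?_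
  · filter_upwards [hev, lpl.eventually_ne (smul_ne_zero (inv_ne_zero hlam0.ne') hs'ne)]
      with k hk hne
    have haU := (hinterior _ _ hk).1
    refine hu.one_le_of_quadratic_touch hf hUo haU hne ?_
    have hT := h₁.taylor (hd₁ (φ k)) (ε := 1 / ((φ k : ℝ) + 1)) (by positivity)
    simp only [hg₁, add_right_comm _ _ k₀] at hT
    filter_upwards [hα.eventually_le_quadratic hT, hUo.mem_nhds haU] with b hb hbU
    have h1 := hb (hUC hbU)
    set d := b - α (z (φ k) + k₀) with hd
    simp only [hp] at h1
    have e : lam * (u (α (z (φ k) + k₀)) + inner ℝ (lam⁻¹ • s₁ (z (φ k))) d +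
        1 / 2 * inner ℝ ((lam⁻¹ • (A₁ (φ k) + (2 * (1 / ((φ k : ℝ) + 1))) • id')) d) d)
        = lam * u (α (z (φ k) + k₀)) + inner ℝ (s₁ (z (φ k))) d +
          1 / 2 * inner ℝ (A₁ (φ k) d) d + 1 / ((φ k : ℝ) + 1) * ‖d‖ ^ 2 := by
      simp only [_root_.add_apply, _root_.smul_apply, hid, ContinuousLinearMap.id_apply,
        real_inner_smul_left, inner_add_left, real_inner_self_eq_norm_sq]
      field_simp
      ring
    refine le_of_mul_le_mul_left ?_ hlam0
    rw [e]
    exact h1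
  · filter_upwards [hev, lq.eventually_ne hs'ne] with k hk hne hK
    have hbU := (hinterior _ _ hk).2
    refine hv.le_one_of_quadratic_touch hf hUo hbU hne ?_ hK
    have hT := hsQ.taylor (hd₂ (φ k)) (ε := 1 / ((φ k : ℝ) + 1)) (by positivity)
    filter_upwards [hβ.eventually_le_quadratic hT, hUo.mem_nhds hbU] with b hb hbU'
    have h1 := hb (hUC hbU')
    set d := b - β (z (φ k)) with hd
    simp only [hq] at h1
    simp only [_root_.neg_apply, _root_.add_apply, _root_.smul_apply, hid,
      ContinuousLinearMap.id_apply, real_inner_smul_left, inner_add_left, inner_neg_left,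
      real_inner_self_eq_norm_sq]
    simp only [hs₂, real_inner_smul_left] at h1 ⊢
    linarith

end Comparison

end GeneralCurvature

theorem mainTheorem7 {n : ℕ} (K : Set (Fin n → ℝ)) (f : (Fin n → ℝ) → ℝ)
    (hf : GeneralCurvature.IsCurvatureFunction K f)
    (U : Set (EuclideanSpace ℝ (Fin n))) (hUo : IsOpen U) (hUb : Bornology.IsBounded U)
    (u v : EuclideanSpace ℝ (Fin n) → ℝ)
    (hu : GeneralCurvature.IsWeakSubsolution K f U u) (hu0 : ∀ x ∈ frontier U, u x ≤ 0)
    (hv : GeneralCurvature.IsWeakSupersolution K f U v) (hv0 : ∀ x ∈ frontier U, 0 ≤ v x) :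
    ∀ x ∈ U, u x ≤ v x := by
  intro x hx
  have hlim : Tendsto (fun lam : ℝ => lam * u x - v x) (𝓝[>] 1) (𝓝 (1 * u x - v x)) := by
    have hc : Continuous fun lam : ℝ => lam * u x - v x := by fun_prop
    exact (hc.tendsto 1).mono_left nhdsWithin_le_nhds
  have h := le_of_tendsto hlim (by
    filter_upwards [self_mem_nhdsWithin] with lam hlam
    exact GeneralCurvature.comparison_of_strict hf hUo hUb hu hu0 hv hv0 hlam hx)
  linarith
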